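/- **Theorem 6.1 (Sobolev inequalities in r.i. spaces).** Let $(\Omega,\mu,d)$ be a connected metric space with a Borel measure $\mu$ that is finite on compact sets and resonant (i.e. $\mu$ is $\sigma$-finite and $\int_0^\infty u_\mu^*v_\mu^*\,dt=\sup\int_\Omega|u\tilde v|\,d\mu$, supremum over all $\tilde v$ equimeasurable with $v$, for all measurable a.e. finite $u,v$), where $u_\mu^*(s)=\inf\{t\ge 0:\mu\{|u|>t\}\le s\}$. Put $$|\nabla f|(x)=\limsup_{d(x,y)\to0}\frac{|f(x)-f(y)|}{d(x,y)},\qquad \mu^+(A)=\liminf_{h\to0^+}\frac{\mu(\{x:d(x,A)<h\})-\mu(A)}{h}.$$ Let $I:[0,\mu(\Omega))\to[0,\infty)$ be an isoperimetric estimator: $I(t)\le\inf\{\mu^+(A): A \text{ Borel},\ \mu(A)=t\}$ for all $t$, and $I$ is concave, continuous, $I(0)=0$, symmetric around $\mu(\Omega)/2$ if $\mu(\Omega)<\infty$, and non-decreasing if $\mu(\Omega)=\infty$ (for example, the isoperimetric profile itself when it has these properties). Let $X$ be a rearrangement invariant Banach function space on $\Omega$ (with the Fatou property), let $\|g\|_{X'}=\sup\{\int_\Omega|fg|\,d\mu:\|f\|_X\le1\}$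 be its associate norm, and let $\bar X$ be its representation space on $(0,\mu(\Omega))$ with Lebesgue measure, $\|h\|_{\bar X}=\sup\{\int_0^{\mu(\Omega)}h^*(t)g_\mu^*(t)\,dt:\|g\|_{X'}\le1\}$, so that $\|f\|_X=\|f_\mu^*\|_{\bar X}$. Suppose that the operator $$\tilde Q_Ig(t)=\frac{I(t)}{t}\int_t^{\mu(\Omega)/2}g(s)\frac{ds}{I(s)}\quad(0<t<\mu(\Omega)/2),\qquad \tilde Q_Ig(t)=0\quad(\mu(\Omega)/2\le t<\mu(\Omega)),$$ is bounded on $\bar X$ with norm $\|\tilde Q_I\|_{\bar X\to\bar X}$. 1. If $\mu(\Omega)<\infty$, then $c_{X,I}:=\left\|\frac{I(t)}{t}\chi_{(0,\mu(\Omega)/2)}(t)\right\|_{\bar X}<\infty$, and for every bounded Lipschitz function $f$ on $\Omega$, $$\left\|f_\mu^*(t)\frac{I(t)}{t}\chi_{(0,\mu(\Omega)/2)}(t)\right\|_{\bar X}\le\|\tilde Q_I\|_{\bar X\to\bar X}\,\big\||\nabla f|\big\|_X+\frac{2c_{X,I}}{\mu(\Omega)}\int_\Omega|f|\,d\mu.$$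 2. If $\mu(\Omega)=\infty$, then for every Lipschitz function $f$ on $\Omega$ with compact support, $$\left\|f_\mu^*(t)\frac{I(t)}{t}\right\|_{\bar X}\le\|\tilde Q_I\|_{\bar X\to\bar X}\,\big\||\nabla f|\big\|_X.$$ -/

import Mathlib

open MeasureTheory Set Filter Topology
open scoped ENNReal NNReal

noncomputable section

namespace RISobolev

/-! ### Metric measure spaces: gradient, Minkowski content, isoperimetric profile -/

section Metric

variable {Ω : Type*} [MetricSpace Ω]

/-- The modulus of the gradient `|∇f|(x) = limsup_{d(x,y) → 0} |f x - f y| / d(x,y)`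
(equal to `0` at an isolated point). -/
def gradMod (f : Ω → ℝ) (x : Ω) : ℝ≥0∞ :=
  limsup (fun y => ENNReal.ofReal (|f x - f y| / dist x y)) (𝓝[≠] x)

/-- `Lip(Ω)`. -/
def IsLip (f : Ω → ℝ) : Prop := ∃ K : ℝ≥0, LipschitzWith K f

/-- `Lip₀(Ω)`: Lipschitz functions with compact support. -/
def IsLipCompact (f : Ω → ℝ) : Prop := IsLip f ∧ HasCompactSupport f

variable [MeasurableSpace Ω]

/-- The perimeter (Minkowski content) `μ⁺(A) = liminf_{h → 0+} (μ(A_h) - μ(A)) / h`, where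
`A_h = {x | d(x, A) < h}`; it is only used for sets of finite measure. -/
def perimeter (μ : Measure Ω) (A : Set Ω) : ℝ≥0∞ :=
  liminf (fun h : ℝ => (μ (Metric.thickening h A) - μ A) / ENNReal.ofReal h) (𝓝[>] 0)

/-- The isoperimetric profile `I_Ω(t) = inf {μ⁺(A) : A Borel, μ(A) = t}`
(with `inf ∅ = ∞`), for `0 ≤ t < μ(Ω)`. -/
def isoProfile (μ : Measure Ω) (t : ℝ) : ℝ≥0∞ :=
  ⨅ (A : Set Ω) (_ : MeasurableSet A) (_ : μ A = ENNReal.ofReal t), perimeter μ A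

/-- `I : [0, μ(Ω)) → ℝ₊` is an isoperimetric estimator: a lower bound of the isoperimetric profile
that is concave, continuous, zero at zero, symmetric around `μ(Ω)/2` if `μ(Ω) < ∞`, and increasing
if `μ(Ω) = ∞`. The isoperimetric profile is itself an estimator as soon as it is
finite and has these properties. -/
structure IsIsoperimetricEstimator (μ : Measure Ω) (I : ℝ → ℝ) : Prop where
  nonneg : ∀ t, 0 ≤ t → ENNReal.ofReal t < μ univ → 0 ≤ I t
  le_profile : ∀ t, 0 ≤ t → ENNReal.ofReal t < μ univ → ENNReal.ofReal (I t) ≤ isoProfile μ t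
  concave : ConcaveOn ℝ {t : ℝ | 0 ≤ t ∧ ENNReal.ofReal t < μ univ} I
  continuous : ContinuousOn I {t : ℝ | 0 ≤ t ∧ ENNReal.ofReal t < μ univ}
  zero : I 0 = 0
  symm : μ univ < ∞ → ∀ t, 0 < t → ENNReal.ofReal t < μ univ → I ((μ univ).toReal - t) = I t
  mono : μ univ = ∞ → MonotoneOn I (Ici 0)

end Metric

/-! ### Rearrangements and rearrangement invariant norms -/

section Rearrangement

variable {α : Type*} [MeasurableSpace α]

/-- The distribution function `t ↦ ν {u > t}` of a nonnegative function (a real function enters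
through its absolute value). -/
def distrib (ν : Measure α) (u : α → ℝ≥0∞) (t : ℝ≥0∞) : ℝ≥0∞ := ν {x | t < u x}

/-- The decreasing rearrangement `u*(s) = inf {t ≥ 0 : ν {u > t} ≤ s}`, for `s ≥ 0`.
It vanishes for `s ≥ ν(α)`. -/
def rearr (ν : Measure α) (u : α → ℝ≥0∞) (s : ℝ) : ℝ≥0∞ :=
  sInf {t : ℝ≥0∞ | distrib ν u t ≤ ENNReal.ofReal s}

/-- Nonnegative measurable functions that are finite almost everywhere. -/
def IsMZero (ν : Measure α) (u : α → ℝ≥0∞) : Prop := AEMeasurable u ν ∧ ∀ᵐ x ∂ν, u x < ∞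

/-- Two functions, possibly on different spaces, are equimeasurable if they have the same
distribution function. -/
def Equimeasurable {β : Type*} [MeasurableSpace β] (ν : Measure α) (u : α → ℝ≥0∞)
    (ν' : Measure β) (v : β → ℝ≥0∞) : Prop :=
  ∀ t : ℝ≥0∞, t < ∞ → distrib ν u t = distrib ν' v t

/-- Resonant measure spaces: `σ`-finite, and for all a.e. finite `u`, `v` the integral of `u* v*`
is the supremum of `∫ u v'` over all `v'` equimeasurable with `v`. -/
structure Resonant (ν : Measure α) : Prop where
  sigmaFinite : SigmaFinite ν
  eq_iSup : ∀ u v : α → ℝ≥0∞, IsMZero ν u → IsMZero ν v →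
    ∫⁻ t in Ioi (0 : ℝ), rearr ν u t * rearr ν v t =
      ⨆ (v' : α → ℝ≥0∞) (_ : IsMZero ν v') (_ : Equimeasurable ν v' ν v), ∫⁻ x, u x * v' x ∂ν

/-- A rearrangement invariant Banach function norm, with the Fatou property. The r.i. space `X`
consists of the measurable `f` with `‖f‖_X = norm |f| < ∞`. -/
structure RINorm (ν : Measure α) where
  /-- the norm of a nonnegative measurable function, possibly infinite -/
  norm : (α → ℝ≥0∞) → ℝ≥0∞
  eq_zero_iff : ∀ f, AEMeasurable f ν → (norm f = 0 ↔ f =ᵐ[ν] 0)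
  smul : ∀ (a : ℝ≥0) f, AEMeasurable f ν → norm (fun x => (a : ℝ≥0∞) * f x) = a * norm f
  add_le : ∀ f g, AEMeasurable f ν → AEMeasurable g ν →
    norm (fun x => f x + g x) ≤ norm f + norm g
  mono : ∀ f g, AEMeasurable f ν → AEMeasurable g ν → f ≤ᵐ[ν] g → norm f ≤ norm g
  fatou : ∀ f : ℕ → α → ℝ≥0∞, (∀ n, AEMeasurable (f n) ν) → (∀ n, f n ≤ᵐ[ν] f (n + 1)) →
    norm (fun x => ⨆ n, f n x) = ⨆ n, norm (f n)
  indicator_lt_top : ∀ E, MeasurableSet E → ν E < ∞ → norm (E.indicator fun _ => 1) < ∞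
  lintegral_le : ∀ E, MeasurableSet E → ν E < ∞ →
    ∃ C : ℝ≥0, ∀ f, AEMeasurable f ν → ∫⁻ x in E, f x ∂ν ≤ C * norm f
  rearr_invariant : ∀ f g, IsMZero ν f → IsMZero ν g → Equimeasurable ν f ν g → norm f = norm g

/-- The associate norm `‖g‖_{X'} = sup {∫ f g : ‖f‖_X ≤ 1}`. -/
def RINorm.assoc {ν : Measure α} (X : RINorm ν) (g : α → ℝ≥0∞) : ℝ≥0∞ :=
  ⨆ (f : α → ℝ≥0∞) (_ : AEMeasurable f ν) (_ : X.norm f ≤ 1), ∫⁻ x, f x * g x ∂ν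

/-- Lebesgue measure on the interval `(0, M)`, `0 ≤ M ≤ ∞`. -/
def intervalMeasure (M : ℝ≥0∞) : Measure ℝ :=
  volume.restrict {t : ℝ | 0 < t ∧ ENNReal.ofReal t < M}

/-- The norm of the Luxemburg representation `X̄` of `X` on `(0, ν(α))` with Lebesgue measure,
`‖h‖_{X̄} = sup {∫₀^∞ h* g* : ‖g‖_{X'} ≤ 1}`. -/
def RINorm.bar {ν : Measure α} (X : RINorm ν) (h : ℝ → ℝ≥0∞) : ℝ≥0∞ :=
  ⨆ (g : α → ℝ≥0∞) (_ : AEMeasurable g ν) (_ : X.assoc g ≤ 1),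
    ∫⁻ t in Ioi (0 : ℝ), rearr (intervalMeasure (ν univ)) h t * rearr ν g t

/-- The isoperimetric Hardy operator
`Q̃_I g(t) = (I(t)/t) ∫_t^{M/2} g(s) ds / I(s)`, `M = ν(α)`, for `g ≥ 0` on `(0, M)`.
For `t ≥ M/2` the value is `0`. -/
def hardyOp (M : ℝ≥0∞) (I : ℝ → ℝ) (g : ℝ → ℝ≥0∞) (t : ℝ) : ℝ≥0∞ :=
  ENNReal.ofReal (I t / t) *
    ∫⁻ s in {s : ℝ | t < s ∧ ENNReal.ofReal s < M / 2}, g s / ENNReal.ofReal (I s)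

/-- `C` is a bound on `X̄` for the positive operator `T`: `‖T g‖ ≤ C ‖g‖` for all `0 ≤ g ∈ X̄`. -/
def RINorm.IsBarBound {ν : Measure α} (X : RINorm ν) (T : (ℝ → ℝ≥0∞) → ℝ → ℝ≥0∞)
    (C : ℝ≥0∞) : Prop :=
  ∀ g : ℝ → ℝ≥0∞, AEMeasurable g (intervalMeasure (ν univ)) → X.bar g < ∞ →
    X.bar (T g) ≤ C * X.bar g

/-- The positive operator `T` is bounded on `X̄`. -/
def RINorm.BarBounded {ν : Measure α} (X : RINorm ν) (T : (ℝ → ℝ≥0∞) → ℝ → ℝ≥0∞) : Prop :=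
  ∃ C : ℝ≥0, X.IsBarBound T C

/-- The operator norm of `T` on `X̄`. -/
def RINorm.barOpNorm {ν : Measure α} (X : RINorm ν) (T : (ℝ → ℝ≥0∞) → ℝ → ℝ≥0∞) : ℝ≥0∞ :=
  sInf {C : ℝ≥0∞ | X.IsBarBound T C}

/-- `c_{X,I} = ‖(I(t)/t) χ_{(0, ν(α)/2)}(t)‖_{X̄}`. -/
def RINorm.constXI {ν : Measure α} (X : RINorm ν) (I : ℝ → ℝ) : ℝ≥0∞ :=
  X.bar ({t : ℝ | 0 < t ∧ ENNReal.ofReal t < ν univ / 2}.indicator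
    fun t => ENNReal.ofReal (I t / t))

end Rearrangement

end RISobolev

end

/-! Write `M = μ(Ω)` and `λ(r) = μ{|f| > r}`. Morally `f*(t) = ∫_t^M ψ` with `ψ = -(f*)'`, so that
up to the value `f*(M/2)` the function `f*(t) I(t)/t` is the Hardy operator applied to `I ψ`. The
theorem thus reduces to `‖I ψ‖_X̄ ≤ ‖|∇f|‖_X`, a rearranged form of the Pólya–Szegő principle.

The coarea inequality (`lintegral_perimeter_le`) and `I(λ(r)) ≤ μ⁺{|f| > r}` bound `∫ I(λ(r)) dr`
over a set of levels by the integral of `|∇f|` over the points with these values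
(`lintegral_levels_le`). If the levels are those with `λ(r) ∈ E`, then up to countably many of them
the points fill a set `G` with `μ(G) ≤ |E|` (`exists_measure_le_lintegral_le`). When `I > 0` this
makes the image of `dr` under `λ` absolutely continuous on `(0, M)`; `ψ` is its density, and `∫_E I
ψ ≤ ∫_G |∇f|`. Taking for `E` the superlevel sets of `I ψ` gives `∫ (I ψ - q)₊ ≤ ∫ (|∇f| - q)₊` for
all `q` (`exists_rearr_density`).

These inequalities are Hardy–Littlewood–Pólya majorization, which passes to the norms by Hardy's
lemma and resonance (`RINorm.bar_le_norm`). The endpoint value costs `f*(M/2) c_{X,I}`, with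
`f*(M/2)` at most twice the mean of `|f|`; for `M = ∞` it is absent. If `I` vanishes at one interior
point it vanishes identically, and the left sides are zero. -/

namespace RISobolev

/-! ### Decreasing rearrangements, majorization and Hardy's lemma. -/

section Rearrangement

variable {α β : Type*} [MeasurableSpace α] [MeasurableSpace β] {ν : Measure α} {ν' : Measure β}

theorem distrib_antitone (ν : Measure α) (u : α → ℝ≥0∞) : Antitone (distrib ν u) :=
  fun _ _ h => measure_mono fun _ hx => lt_of_le_of_lt h hx

/-- Right continuity of the distribution function, as a Galois connection. -/
theorem rearr_le_iff {u : α → ℝ≥0∞} {s : ℝ} {q : ℝ≥0∞} :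
    rearr ν u s ≤ q ↔ distrib ν u q ≤ ENNReal.ofReal s := by
  refine ⟨fun h => ?_, fun h => sInf_le h⟩
  refine le_trans (distrib_antitone ν u h) ?_
  have hlt : ∀ r, rearr ν u s < r → distrib ν u r ≤ ENNReal.ofReal s := by
    intro r hr
    obtain ⟨p, hp, hpr⟩ := sInf_lt_iff.1 hr
    exact (distrib_antitone ν u hpr.le).trans hp
  rcases eq_or_ne (rearr ν u s) ∞ with h0 | h0
  · simp [h0, distrib]
  · obtain ⟨v, hv, hvmem, hvlim⟩ := exists_seq_strictAnti_tendsto' (lt_top_iff_ne_top.2 h0)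
    have : {x | rearr ν u s < u x} = ⋃ n, {x | v n < u x} := by
      ext x
      simp only [mem_ofPred_eq, mem_iUnion]
      constructor
      · intro hx
        exact ((hvlim.eventually (gt_mem_nhds hx))).exists
      · rintro ⟨n, hn⟩
        exact (hvmem n).1.trans hn
    rw [distrib, this, Monotone.measure_iUnion]
    · exact iSup_le fun n => hlt _ (hvmem n).1
    · intro m n hmn x hx
      exact lt_of_le_of_lt (hv.antitone hmn) hx

theorem lt_rearr_iff {u : α → ℝ≥0∞} {s : ℝ} {q : ℝ≥0∞} :
    q < rearr ν u s ↔ ENNReal.ofReal s < distrib ν u q := by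
  simpa using rearr_le_iff.not

theorem rearr_antitone (ν : Measure α) (u : α → ℝ≥0∞) : Antitone (rearr ν u) := fun _ _ h =>
  rearr_le_iff.2 ((rearr_le_iff.1 le_rfl).trans (ENNReal.ofReal_le_ofReal h))

theorem measurable_rearr (ν : Measure α) (u : α → ℝ≥0∞) : Measurable (rearr ν u) :=
  (rearr_antitone ν u).measurable

theorem distrib_mono_ae {u v : α → ℝ≥0∞} (h : u ≤ᵐ[ν] v) (q : ℝ≥0∞) :
    distrib ν u q ≤ distrib ν v q :=
  measure_mono_ae (h.mono fun _ hx (hq : q < _) => lt_of_lt_of_le hq hx)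

theorem rearr_mono_ae {u v : α → ℝ≥0∞} (h : u ≤ᵐ[ν] v) (s : ℝ) : rearr ν u s ≤ rearr ν v s :=
  rearr_le_iff.2 ((distrib_mono_ae h _).trans (rearr_le_iff.1 le_rfl))

theorem rearr_const_mul_le (c : ℝ≥0∞) (u : α → ℝ≥0∞) (s : ℝ) :
    rearr ν (fun x => c * u x) s ≤ c * rearr ν u s := by
  refine rearr_le_iff.2 (le_trans (measure_mono ?_) (rearr_le_iff.1 (le_refl (rearr ν u s))))
  intro x (hx : c * rearr ν u s < c * u x)
  exact lt_of_mul_lt_mul_left' hx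

/-- Turns an extended nonnegative value into the length of the real levels below it; every
layer-cake argument below rests on this. -/
theorem volume_ofReal_lt (a : ℝ≥0∞) :
    volume {q : ℝ | 0 < q ∧ ENNReal.ofReal q < a} = a := by
  rcases eq_or_ne a ∞ with rfl | ha
  · have : {q : ℝ | 0 < q ∧ ENNReal.ofReal q < ∞} = Ioi 0 := by ext; simp
    rw [this, Real.volume_Ioi]
  · have : {q : ℝ | 0 < q ∧ ENNReal.ofReal q < a} = Ioo 0 a.toReal := by
      ext q
      simp only [mem_ofPred_eq, mem_Ioo]
      refine and_congr_right fun hq => ?_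
      rw [ENNReal.ofReal_lt_iff_lt_toReal hq.le ha]
    rw [this, Real.volume_Ioo, sub_zero, ENNReal.ofReal_toReal ha]

theorem measurableSet_ofReal_lt (a : ℝ≥0∞) :
    MeasurableSet {q : ℝ | 0 < q ∧ ENNReal.ofReal q < a} :=
  measurableSet_Ioi.inter (measurableSet_lt ENNReal.measurable_ofReal measurable_const)

theorem volume_le_ofReal_lt (r a : ℝ≥0∞) :
    volume {q : ℝ | 0 < q ∧ r ≤ ENNReal.ofReal q ∧ ENNReal.ofReal q < a} = a - r := by
  have : {q : ℝ | 0 < q ∧ r ≤ ENNReal.ofReal q ∧ ENNReal.ofReal q < a} =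
      {q : ℝ | 0 < q ∧ ENNReal.ofReal q < a} \ {q : ℝ | 0 < q ∧ ENNReal.ofReal q < min a r} := by
    ext q
    simp only [mem_ofPred_eq, Set.mem_sdiff, lt_min_iff, not_and, not_lt]
    tauto
  rcases eq_or_ne (min a r) ∞ with h | h
  · have hr : r = ∞ := by
      rw [eq_top_iff, ← h]; exact min_le_right _ _
    have : {q : ℝ | 0 < q ∧ r ≤ ENNReal.ofReal q ∧ ENNReal.ofReal q < a} = ∅ := by
      ext q; simp [hr]
    rw [this, hr]; simp
  · rw [this, measure_sdiff, volume_ofReal_lt, volume_ofReal_lt]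
    · rcases le_total a r with h' | h' <;> simp [h', tsub_eq_zero_of_le]
    · exact fun q hq => ⟨hq.1, lt_of_lt_of_le hq.2 (min_le_left _ _)⟩
    · exact (measurableSet_ofReal_lt _).nullMeasurableSet
    · rwa [volume_ofReal_lt]

theorem lintegral_sub_eq_lintegral_distrib [SFinite ν] {u : α → ℝ≥0∞} (hu : AEMeasurable u ν)
    (r : ℝ≥0∞) :
    ∫⁻ x, (u x - r) ∂ν =
      ∫⁻ q in Ioi (0 : ℝ), {q : ℝ | r ≤ ENNReal.ofReal q}.indicator
        (fun q => distrib ν u (ENNReal.ofReal q)) q := by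
  obtain ⟨v, hv, huv⟩ := hu
  have hd : ∀ q, distrib ν u q = distrib ν v q := fun q =>
    le_antisymm (distrib_mono_ae huv.le q) (distrib_mono_ae huv.symm.le q)
  rw [lintegral_congr_ae (huv.mono fun x hx => by simp only [hx] : _ =ᵐ[ν] fun x => v x - r)]
  simp only [hd]
  have hS : MeasurableSet {p : α × ℝ | r ≤ ENNReal.ofReal p.2 ∧ ENNReal.ofReal p.2 < v p.1} := by
    have h1 : MeasurableSet {p : α × ℝ | r ≤ ENNReal.ofReal p.2} :=
      measurableSet_le measurable_const (by fun_prop)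
    have h2 : MeasurableSet {p : α × ℝ | ENNReal.ofReal p.2 < v p.1} :=
      measurableSet_lt (by fun_prop) (by fun_prop)
    exact h1.inter h2
  have h1 : ∀ x, v x - r = ∫⁻ q in Ioi (0 : ℝ),
      {p : α × ℝ | r ≤ ENNReal.ofReal p.2 ∧ ENNReal.ofReal p.2 < v p.1}.indicator 1 (x, q) := by
    intro x
    rw [← volume_le_ofReal_lt]
    have hm : MeasurableSet {q : ℝ | r ≤ ENNReal.ofReal q ∧ ENNReal.ofReal q < v x} :=
      measurable_prodMk_left hS
    have := lintegral_indicator_one (μ := volume.restrict (Ioi (0 : ℝ))) hm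
    rw [Measure.restrict_apply hm, inter_comm] at this
    exact this.symm
  simp_rw [h1]
  rw [lintegral_lintegral_swap]
  · refine lintegral_congr fun q => ?_
    by_cases hq : r ≤ ENNReal.ofReal q
    · rw [indicator_of_mem (show q ∈ {q : ℝ | r ≤ ENNReal.ofReal q} from hq)]
      have hm : MeasurableSet {x : α | ENNReal.ofReal q < v x} :=
        measurableSet_lt measurable_const hv
      rw [distrib, ← lintegral_indicator_one hm]
      refine lintegral_congr fun x => ?_
      simp [indicator, hq]
    · simp [indicator, hq]
  · exact (measurable_one.indicator hS).aemeasurable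

/-- Tonelli on the region under the graph of `u*`: by `lt_rearr_iff`, its slice at height `q` over
`(0, T)` is an interval starting at `0`. -/
theorem lintegral_rearr_eq (ν : Measure α) (u : α → ℝ≥0∞) (T : ℝ≥0∞) :
    ∫⁻ s in {s : ℝ | 0 < s ∧ ENNReal.ofReal s < T}, rearr ν u s =
      ∫⁻ q in Ioi (0 : ℝ), min T (distrib ν u (ENNReal.ofReal q)) := by
  have hS : MeasurableSet {p : ℝ × ℝ | ENNReal.ofReal p.2 < rearr ν u p.1} :=
    measurableSet_lt (by fun_prop) ((measurable_rearr ν u).comp measurable_fst)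
  have h1 : ∀ s, rearr ν u s = ∫⁻ q in Ioi (0 : ℝ),
      {p : ℝ × ℝ | ENNReal.ofReal p.2 < rearr ν u p.1}.indicator 1 (s, q) := by
    intro s
    have hm : MeasurableSet {q : ℝ | ENNReal.ofReal q < rearr ν u s} :=
      measurable_prodMk_left hS
    have := lintegral_indicator_one (μ := volume.restrict (Ioi (0 : ℝ))) hm
    rw [Measure.restrict_apply hm, inter_comm] at this
    rw [← volume_ofReal_lt (rearr ν u s)]
    exact this.symm
  rw [lintegral_congr h1, lintegral_lintegral_swap]
  · refine lintegral_congr fun q => ?_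
    rw [← volume_ofReal_lt (min T _)]
    have hm : MeasurableSet {s : ℝ | ENNReal.ofReal q < rearr ν u s} :=
      measurable_prodMk_right hS
    have := lintegral_indicator_one
      (μ := volume.restrict {s : ℝ | 0 < s ∧ ENNReal.ofReal s < T}) hm
    rw [Measure.restrict_apply hm] at this
    refine Eq.trans this ?_
    congr 1
    ext s
    simp only [mem_inter_iff, mem_ofPred_eq, lt_rearr_iff, lt_min_iff]
    tauto
  · exact (measurable_one.indicator hS).aemeasurable

theorem lintegral_sub_add_eq [SFinite ν] {u : α → ℝ≥0∞} (hu : AEMeasurable u ν) (r T : ℝ≥0∞) :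
    ∫⁻ x, (u x - r) ∂ν + r * T = ∫⁻ q in Ioi (0 : ℝ),
      if r ≤ ENNReal.ofReal q then distrib ν u (ENNReal.ofReal q) else T := by
  rw [lintegral_sub_eq_lintegral_distrib hu]
  have h2 : r * T = ∫⁻ q in Ioi (0 : ℝ), {q : ℝ | ENNReal.ofReal q < r}.indicator
      (fun _ => T) q := by
    have hm : MeasurableSet {q : ℝ | ENNReal.ofReal q < r} :=
      measurableSet_lt ENNReal.measurable_ofReal measurable_const
    rw [lintegral_indicator hm, setLIntegral_const, Measure.restrict_apply hm, inter_comm,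
      mul_comm]
    congr 1
    exact (volume_ofReal_lt r).symm
  rw [h2, ← lintegral_add_right]
  · refine lintegral_congr fun q => ?_
    by_cases hq : r ≤ ENNReal.ofReal q
    · simp [indicator, hq, not_lt.2 hq]
    · simp [indicator, hq, not_le.1 hq]
  · exact measurable_const.indicator
      (measurableSet_lt ENNReal.measurable_ofReal measurable_const)

/-- With the next lemma: `∫₀ᵀ u*` is the minimum over `r` of `∫ (u - r)₊ + r T`. At each height the
right side picks one of the two terms of `min T (distrib ν u q)`; the choice `r = u*(T)` picks the
smaller one. -/
theorem lintegral_rearr_le [SFinite ν] {u : α → ℝ≥0∞} (hu : AEMeasurable u ν) (r T : ℝ≥0∞) :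
    ∫⁻ s in {s : ℝ | 0 < s ∧ ENNReal.ofReal s < T}, rearr ν u s ≤
      ∫⁻ x, (u x - r) ∂ν + r * T := by
  rw [lintegral_sub_add_eq hu, lintegral_rearr_eq]
  refine lintegral_mono fun q => ?_
  dsimp only
  split_ifs
  exacts [min_le_right _ _, min_le_left _ _]

theorem exists_lintegral_rearr_eq [SFinite ν] {u : α → ℝ≥0∞} (hu : AEMeasurable u ν)
    (T : ℝ≥0∞) :
    ∃ r, ∫⁻ s in {s : ℝ | 0 < s ∧ ENNReal.ofReal s < T}, rearr ν u s =
      ∫⁻ x, (u x - r) ∂ν + r * T := by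
  rcases eq_or_ne T ∞ with rfl | hT
  · refine ⟨0, ?_⟩
    rw [lintegral_sub_add_eq hu, lintegral_rearr_eq]
    simp
  · refine ⟨rearr ν u T.toReal, ?_⟩
    rw [lintegral_sub_add_eq hu, lintegral_rearr_eq]
    refine lintegral_congr fun q => ?_
    split_ifs with h
    · rw [rearr_le_iff, ENNReal.ofReal_toReal hT] at h
      exact min_eq_right h
    · rw [rearr_le_iff, ENNReal.ofReal_toReal hT, not_le] at h
      exact min_eq_left h.le

theorem lintegral_rearr_top [SFinite ν] {u : α → ℝ≥0∞} (hu : AEMeasurable u ν) :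
    ∫⁻ s in Ioi (0 : ℝ), rearr ν u s = ∫⁻ x, u x ∂ν := by
  have h1 := lintegral_rearr_eq ν u ∞
  have h2 := lintegral_sub_add_eq hu 0 ∞
  have : {s : ℝ | 0 < s ∧ ENNReal.ofReal s < ∞} = Ioi 0 := by ext; simp
  rw [this] at h1
  simp only [tsub_zero, zero_mul, add_zero, zero_le, if_true] at h2
  simpa [h2] using h1

theorem lintegral_rearr_le_of_lintegral_sub_le [SFinite ν] [SFinite ν'] {u : α → ℝ≥0∞}
    {v : β → ℝ≥0∞} (hu : AEMeasurable u ν) (hv : AEMeasurable v ν')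
    (h : ∀ r, ∫⁻ x, (u x - r) ∂ν ≤ ∫⁻ x, (v x - r) ∂ν') (T : ℝ≥0∞) :
    ∫⁻ s in {s : ℝ | 0 < s ∧ ENNReal.ofReal s < T}, rearr ν u s ≤
      ∫⁻ s in {s : ℝ | 0 < s ∧ ENNReal.ofReal s < T}, rearr ν' v s := by
  obtain ⟨r, hr⟩ := exists_lintegral_rearr_eq hv T
  rw [hr]
  exact (lintegral_rearr_le hu r T).trans (by gcongr; exact h r)

/-- Add the optimal cuts `r`, `r'` of `u` and `v` and use `(u + v - r - r')₊ ≤ (u - r)₊ + (v -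
r')₊`. -/
theorem lintegral_rearr_add_le [SFinite ν] {u v : α → ℝ≥0∞} (hu : AEMeasurable u ν)
    (hv : AEMeasurable v ν) (T : ℝ≥0∞) :
    ∫⁻ s in {s : ℝ | 0 < s ∧ ENNReal.ofReal s < T}, rearr ν (fun x => u x + v x) s ≤
      ∫⁻ s in {s : ℝ | 0 < s ∧ ENNReal.ofReal s < T}, (rearr ν u s + rearr ν v s) := by
  obtain ⟨r, hr⟩ := exists_lintegral_rearr_eq hu T
  obtain ⟨r', hr'⟩ := exists_lintegral_rearr_eq hv T
  rw [lintegral_add_left (measurable_rearr ν u), hr, hr']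
  calc _ ≤ ∫⁻ x, (u x + v x - (r + r')) ∂ν + (r + r') * T := lintegral_rearr_le (hu.add hv) _ T
    _ ≤ ∫⁻ x, ((u x - r) + (v x - r')) ∂ν + (r + r') * T := by
      gcongr
      exact add_tsub_add_le_tsub_add_tsub
    _ = _ := by
      rw [lintegral_add_left' (by fun_prop)]
      ring

/-- **Hardy's lemma.** -/
theorem lintegral_mul_rearr_le {a b : ℝ → ℝ≥0∞} (ha : Measurable a) (hb : Measurable b)
    (h : ∀ T : ℝ≥0∞, ∫⁻ s in {s : ℝ | 0 < s ∧ ENNReal.ofReal s < T}, a s ≤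
      ∫⁻ s in {s : ℝ | 0 < s ∧ ENNReal.ofReal s < T}, b s) (g : α → ℝ≥0∞) :
    ∫⁻ s in Ioi (0 : ℝ), a s * rearr ν g s ≤ ∫⁻ s in Ioi (0 : ℝ), b s * rearr ν g s := by
  have hS : MeasurableSet {p : ℝ × ℝ | ENNReal.ofReal p.2 < rearr ν g p.1} :=
    measurableSet_lt (by fun_prop) ((measurable_rearr ν g).comp measurable_fst)
  -- Since `g*` is decreasing, it is a superposition of indicators of intervals starting at `0`, and
  -- on these the hypothesis applies.
  have key : ∀ c : ℝ → ℝ≥0∞, Measurable c → ∫⁻ s in Ioi (0 : ℝ), c s * rearr ν g s =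
      ∫⁻ q in Ioi (0 : ℝ),
        ∫⁻ s in {s : ℝ | 0 < s ∧ ENNReal.ofReal s < distrib ν g (ENNReal.ofReal q)}, c s := by
    intro c hc
    have h1 : ∀ s, c s * rearr ν g s = ∫⁻ q in Ioi (0 : ℝ),
        {p : ℝ × ℝ | ENNReal.ofReal p.2 < rearr ν g p.1}.indicator (fun p => c p.1) (s, q) := by
      intro s
      have hm : MeasurableSet {q : ℝ | ENNReal.ofReal q < rearr ν g s} :=
        measurable_prodMk_left hS
      have := lintegral_indicator_const (μ := volume.restrict (Ioi (0 : ℝ))) hm (c s)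
      rw [Measure.restrict_apply hm, inter_comm] at this
      conv_lhs => rw [← volume_ofReal_lt (rearr ν g s)]
      exact this.symm
    rw [lintegral_congr h1, lintegral_lintegral_swap]
    · refine lintegral_congr fun q => ?_
      have hm : MeasurableSet {s : ℝ | ENNReal.ofReal q < rearr ν g s} :=
        measurable_prodMk_right hS
      have := lintegral_indicator (μ := volume.restrict (Ioi (0 : ℝ))) hm c
      rw [Measure.restrict_restrict hm, inter_comm] at this
      refine Eq.trans this ?_
      congr 2
      ext s
      simp only [mem_inter_iff, mem_ofPred_eq, lt_rearr_iff, mem_Ioi]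
    · exact ((hc.comp measurable_fst).indicator hS).aemeasurable
  rw [key a ha, key b hb]
  exact lintegral_mono fun q => h _

end Rearrangement

/-! ### The representation norm and its comparison with the norm of `X`. -/

instance (M : ℝ≥0∞) : SFinite (intervalMeasure M) := by
  unfold intervalMeasure; infer_instance

theorem intervalMeasure_univ (M : ℝ≥0∞) : intervalMeasure M univ = M := by
  rw [intervalMeasure, Measure.restrict_apply_univ, volume_ofReal_lt]

namespace RINorm

variable {α : Type*} [MeasurableSpace α] {ν : Measure α} (X : RINorm ν)

theorem bar_mono {h h' : ℝ → ℝ≥0∞} (hh : h ≤ᵐ[intervalMeasure (ν univ)] h') :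
    X.bar h ≤ X.bar h' :=
  iSup_mono fun _ => iSup_mono fun _ => iSup_mono fun _ => lintegral_mono fun _ =>
    mul_le_mul_left (rearr_mono_ae hh _) _

theorem bar_const_mul_le (c : ℝ≥0∞) (h : ℝ → ℝ≥0∞) :
    X.bar (fun t => c * h t) ≤ c * X.bar h := by
  refine iSup_le fun g => iSup_le fun hg => iSup_le fun hg1 => ?_
  calc _ ≤ ∫⁻ t in Ioi (0 : ℝ), c * (rearr (intervalMeasure (ν univ)) h t * rearr ν g t) := by
        refine lintegral_mono fun t => ?_
        dsimp only
        rw [← mul_assoc]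
        gcongr
        exact rearr_const_mul_le c h t
    _ = c * ∫⁻ t in Ioi (0 : ℝ), rearr (intervalMeasure (ν univ)) h t * rearr ν g t :=
        lintegral_const_mul _ ((measurable_rearr _ _).mul (measurable_rearr _ _))
    _ ≤ _ := by
        gcongr
        exact le_iSup_of_le g (le_iSup_of_le hg (le_iSup_of_le hg1 le_rfl))

theorem bar_zero : X.bar (fun _ => 0) = 0 := by
  simpa using X.bar_const_mul_le 0 (fun _ => 0)

theorem bar_add_le {h h' : ℝ → ℝ≥0∞} (hh : AEMeasurable h (intervalMeasure (ν univ)))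
    (hh' : AEMeasurable h' (intervalMeasure (ν univ))) :
    X.bar (fun t => h t + h' t) ≤ X.bar h + X.bar h' := by
  refine iSup_le fun g => iSup_le fun hg => iSup_le fun hg1 => ?_
  refine (lintegral_mul_rearr_le (measurable_rearr _ _)
    ((measurable_rearr _ h).add (measurable_rearr _ h')) (lintegral_rearr_add_le hh hh') g).trans ?_
  simp only [Pi.add_apply, add_mul]
  rw [lintegral_add_left (f := fun s => rearr _ h s * rearr ν g s)
    ((measurable_rearr _ _).mul (measurable_rearr _ _))]
  exact add_le_add (le_iSup_of_le g (le_iSup_of_le hg (le_iSup_of_le hg1 le_rfl)))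
    (le_iSup_of_le g (le_iSup_of_le hg (le_iSup_of_le hg1 le_rfl)))

theorem ae_lt_top_of_setLIntegral_lt_top [SigmaFinite ν] {f : α → ℝ≥0∞} (hf : AEMeasurable f ν)
    (h : ∀ E, MeasurableSet E → ν E < ∞ → ∫⁻ x in E, f x ∂ν < ∞) : ∀ᵐ x ∂ν, f x < ∞ := by
  rw [← Measure.restrict_univ (μ := ν), ← iUnion_spanningSets ν, ae_restrict_iUnion_iff]
  exact fun n => ae_lt_top' hf.restrict
    (h _ (measurableSet_spanningSets ν n) (measure_spanningSets_lt_top ν n)).ne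

theorem isMZero_of_norm_lt_top [SigmaFinite ν] {f : α → ℝ≥0∞} (hf : AEMeasurable f ν)
    (h : X.norm f < ∞) : IsMZero ν f := by
  refine ⟨hf, ae_lt_top_of_setLIntegral_lt_top hf fun E hE hE' => ?_⟩
  obtain ⟨C, hC⟩ := X.lintegral_le E hE hE'
  exact (hC f hf).trans_lt (ENNReal.mul_lt_top ENNReal.coe_lt_top h)

/-- **Hölder's inequality** for the associate norm. -/
theorem lintegral_mul_le_norm {f g : α → ℝ≥0∞} (hf : AEMeasurable f ν)
    (hg : X.assoc g ≤ 1) : ∫⁻ x, f x * g x ∂ν ≤ X.norm f := by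
  rcases eq_or_ne (X.norm f) 0 with h0 | h0
  · have hz := (X.eq_zero_iff f hf).1 h0
    have hfg : (fun x => f x * g x) =ᵐ[ν] fun _ => 0 := hz.mono fun x hx => by simp [hx]
    rw [lintegral_congr_ae hfg, lintegral_zero]
    exact zero_le
  rcases eq_or_ne (X.norm f) ∞ with h1 | h1
  · simp [h1]
  obtain ⟨c, hc⟩ : ∃ c : ℝ≥0, (c : ℝ≥0∞) = (X.norm f)⁻¹ :=
    ⟨_, ENNReal.coe_toNNReal (ENNReal.inv_ne_top.2 h0)⟩
  have h2 : ∫⁻ x, (c : ℝ≥0∞) * f x * g x ∂ν ≤ 1 := by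
    refine le_trans ?_ hg
    refine le_iSup_of_le (fun x => (c : ℝ≥0∞) * f x) (le_iSup_of_le (hf.const_mul _)
      (le_iSup_of_le ?_ le_rfl))
    rw [X.smul c f hf, hc, ENNReal.inv_mul_cancel h0 h1]
  simp only [mul_assoc] at h2
  rw [lintegral_const_mul' _ _ ENNReal.coe_ne_top, hc, mul_comm, ← div_eq_mul_inv] at h2
  simpa using (ENNReal.div_le_iff h0 h1).1 h2

/-- Hölder against indicators makes `g` integrable on sets of finite measure. Resonance applies only
to a.e. finite functions. -/
theorem isMZero_of_assoc_le_one [SigmaFinite ν] {g : α → ℝ≥0∞} (hg : AEMeasurable g ν)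
    (h : X.assoc g ≤ 1) : IsMZero ν g := by
  refine ⟨hg, ae_lt_top_of_setLIntegral_lt_top hg fun E hE hE' => ?_⟩
  have := X.lintegral_mul_le_norm (f := E.indicator fun _ => 1)
    (aemeasurable_const.indicator hE) h
  have heq : ∀ x, E.indicator (fun _ => 1) x * g x = E.indicator g x := fun x => by
    by_cases hx : x ∈ E <;> simp [hx]
  simp only [heq] at this
  rw [lintegral_indicator hE] at this
  exact this.trans_lt (X.indicator_lt_top E hE hE')

/-- The factors are swapped so that resonance takes the supremum over functions `v'` equimeasurable
with `v`; these all have the norm of `v`, and Hölder applies to each. -/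
theorem lintegral_rearr_mul_rearr_le (hν : Resonant ν) {v g : α → ℝ≥0∞} (hv : IsMZero ν v)
    (hg : AEMeasurable g ν) (h : X.assoc g ≤ 1) :
    ∫⁻ t in Ioi (0 : ℝ), rearr ν v t * rearr ν g t ≤ X.norm v := by
  have := hν.sigmaFinite
  simp only [mul_comm (rearr ν v _)]
  rw [hν.eq_iSup g v (X.isMZero_of_assoc_le_one hg h) hv]
  refine iSup_le fun v' => iSup_le fun hv' => iSup_le fun hvv' => ?_
  simp only [mul_comm (g _)]
  rw [← X.rearr_invariant v' v hv' hv hvv']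
  exact X.lintegral_mul_le_norm hv'.1 h

theorem bar_le_norm (hν : Resonant ν) {φ : ℝ → ℝ≥0∞} {v : α → ℝ≥0∞}
    (hφ : AEMeasurable φ (intervalMeasure (ν univ))) (hv : IsMZero ν v)
    (h : ∀ r, ∫⁻ t, (φ t - r) ∂intervalMeasure (ν univ) ≤ ∫⁻ x, (v x - r) ∂ν) :
    X.bar φ ≤ X.norm v := by
  have := hν.sigmaFinite
  refine iSup_le fun g => iSup_le fun hg => iSup_le fun hg1 => ?_
  refine le_trans ?_ (X.lintegral_rearr_mul_rearr_le hν hv hg hg1)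
  exact lintegral_mul_rearr_le (measurable_rearr _ _) (measurable_rearr _ _)
    (lintegral_rearr_le_of_lintegral_sub_le hφ hv.1 h) g

theorem bar_one_lt_top (hν : Resonant ν) (h : ν univ < ∞) : X.bar (fun _ => 1) < ∞ := by
  have h1 := X.indicator_lt_top univ MeasurableSet.univ h
  rw [indicator_univ] at h1
  refine (X.bar_le_norm hν aemeasurable_const ⟨aemeasurable_const, by simp⟩ fun r => ?_).trans_lt h1
  simp [intervalMeasure_univ]

/-- The infimum is attained: multiplication by the finite number `X.bar g` commutes with it. -/
theorem isBarBound_barOpNorm {T : (ℝ → ℝ≥0∞) → ℝ → ℝ≥0∞} (hT : X.BarBounded T) :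
    X.IsBarBound T (X.barOpNorm T) := by
  intro g hg hg1
  obtain ⟨C, hC⟩ := hT
  have : Nonempty {C : ℝ≥0∞ | X.IsBarBound T C} := ⟨⟨C, hC⟩⟩
  rw [barOpNorm, sInf_eq_iInf', ENNReal.iInf_mul fun h => absurd h hg1.ne]
  exact le_iInf fun c => c.2 g hg hg1

end RINorm

/-! ### The modulus of the gradient and the coarea inequality. -/

section Metric

variable {Ω : Type*} [MetricSpace Ω]

theorem gradMod_eq_iInf (f : Ω → ℝ) (x : Ω) :
    gradMod f x = ⨅ n : ℕ, ⨆ y ∈ Metric.ball x (1 / ((n : ℝ) + 1)) ∩ {x}ᶜ,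
      ENNReal.ofReal (|f x - f y| / dist x y) := by
  rw [gradMod, (nhdsWithin_hasBasis Metric.nhds_basis_ball_inv_nat_succ
    ({x}ᶜ : Set Ω)).limsup_eq_iInf_iSup]
  simp

/-- For a fixed radius the supremum of slopes is lower semicontinuous: exchanging the roles of `x`
and `y` exhibits its superlevel sets as unions over `y` of open sets. Countably many radii suffice.
-/
theorem measurable_gradMod [MeasurableSpace Ω] [BorelSpace Ω] {f : Ω → ℝ} (hf : Continuous f) :
    Measurable (gradMod f) := by
  simp only [funext (gradMod_eq_iInf f)]
  refine Measurable.iInf fun n => measurable_of_Ioi fun a => IsOpen.measurableSet ?_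
  have : (fun x => ⨆ y ∈ Metric.ball x (1 / ((n : ℝ) + 1)) ∩ {x}ᶜ,
      ENNReal.ofReal (|f x - f y| / dist x y)) ⁻¹' Ioi a =
      ⋃ y, (Metric.ball y (1 / ((n : ℝ) + 1)) ∩ ({y}ᶜ ∩
        (fun x => ENNReal.ofReal (|f x - f y| / dist x y)) ⁻¹' Ioi a)) := by
    ext x
    simp only [mem_preimage, mem_Ioi, lt_iSup_iff, mem_iUnion, mem_inter_iff, mem_compl_iff,
      mem_singleton_iff, Metric.mem_ball, exists_prop, dist_comm x, eq_comm (a := x), and_assoc]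
  rw [this]
  refine isOpen_iUnion fun y => Metric.isOpen_ball.inter ?_
  refine ContinuousOn.isOpen_inter_preimage ?_ isOpen_compl_singleton isOpen_Ioi
  refine ENNReal.continuous_ofReal.comp_continuousOn (ContinuousOn.div (by fun_prop) (by fun_prop) ?_)
  exact fun x hx => dist_ne_zero.2 hx

theorem ofReal_slope_le {f : Ω → ℝ} {K : ℝ≥0} (hf : LipschitzWith K f) (x y : Ω) :
    ENNReal.ofReal (|f x - f y| / dist x y) ≤ K := by
  rw [← ENNReal.ofReal_coe_nnreal]
  refine ENNReal.ofReal_le_ofReal (div_le_of_le_mul₀ dist_nonneg K.2 ?_)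
  simpa [Real.dist_eq] using hf.dist_le_mul x y

theorem gradMod_le {f : Ω → ℝ} {K : ℝ≥0} (hf : LipschitzWith K f) (x : Ω) : gradMod f x ≤ K :=
  limsup_le_of_le (by isBoundedDefault) (Eventually.of_forall fun y => ofReal_slope_le hf x y)

theorem gradMod_eq_zero {f : Ω → ℝ} {x : Ω} (h : x ∉ tsupport f) : gradMod f x = 0 := by
  rw [notMem_tsupport_iff_eventuallyEq] at h
  refine le_antisymm (limsup_le_of_le (by isBoundedDefault) ?_) zero_le
  filter_upwards [nhdsWithin_le_nhds h] with y hy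
  simp [h.self_of_nhds, hy]

theorem gradMod_le_indicator {f : Ω → ℝ} {K : ℝ≥0} (hf : LipschitzWith K f) {A : Set Ω}
    (hA : tsupport f ⊆ A) (x : Ω) : gradMod f x ≤ K * A.indicator (fun _ => 1) x := by
  by_cases hx : x ∈ A
  · simpa [hx] using gradMod_le hf x
  · rw [gradMod_eq_zero fun h => hx (hA h)]
    exact zero_le

theorem gradMod_abs_le (f : Ω → ℝ) (x : Ω) : gradMod (fun y => |f y|) x ≤ gradMod f x := by
  refine limsup_le_limsup (Eventually.of_forall fun y => ENNReal.ofReal_le_ofReal ?_)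
    (by isBoundedDefault) (by isBoundedDefault)
  exact div_le_div_of_nonneg_right (abs_abs_sub_abs_le _ _) dist_nonneg

/-- A level counted here is exceeded at some `y` within `δ` of `x`, so it lies above `u x` by at
most the largest slope times `δ`. -/
theorem volume_levels_le {u : Ω → ℝ} {K : ℝ≥0} (hu : LipschitzWith K u) (x : Ω) (δ : ℝ) :
    volume {r : ℝ | u x ≤ r ∧ x ∈ Metric.thickening δ {y | r < u y}} ≤
      (⨆ y ∈ Metric.ball x δ ∩ {x}ᶜ, ENNReal.ofReal (|u x - u y| / dist x y)) *
        ENNReal.ofReal δ := by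
  set Q := ⨆ y ∈ Metric.ball x δ ∩ {x}ᶜ, ENNReal.ofReal (|u x - u y| / dist x y) with hQ
  have hQK : Q ≤ K := iSup₂_le fun y _ => ofReal_slope_le hu x y
  have hQtop : Q * ENNReal.ofReal δ ≠ ∞ :=
    ENNReal.mul_ne_top (hQK.trans_lt ENNReal.coe_lt_top).ne ENNReal.ofReal_ne_top
  have hsub : {r : ℝ | u x ≤ r ∧ x ∈ Metric.thickening δ {y | r < u y}} ⊆
      Icc (u x) (u x + (Q * ENNReal.ofReal δ).toReal) := by
    rintro r ⟨hr, hx⟩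
    obtain ⟨y, hy : r < u y, hxy⟩ := Metric.mem_thickening_iff.1 hx
    refine ⟨hr, ?_⟩
    have hne : y ≠ x := by rintro rfl; exact absurd hy (not_lt.2 hr)
    have hpos : 0 < dist x y := dist_pos.2 hne.symm
    have h1 : ENNReal.ofReal (|u x - u y| / dist x y) ≤ Q :=
      le_iSup₂_of_le y ⟨by rwa [Metric.mem_ball, dist_comm], hne⟩ le_rfl
    have h2 : ENNReal.ofReal (u y - u x) ≤ Q * ENNReal.ofReal δ := by
      calc ENNReal.ofReal (u y - u x) ≤ ENNReal.ofReal (|u x - u y| / dist x y * dist x y) := by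
            rw [div_mul_cancel₀ _ hpos.ne', abs_sub_comm]
            exact ENNReal.ofReal_le_ofReal (le_abs_self _)
        _ = ENNReal.ofReal (|u x - u y| / dist x y) * ENNReal.ofReal (dist x y) :=
            ENNReal.ofReal_mul (by positivity)
        _ ≤ _ := by gcongr
    have h3 := (ENNReal.ofReal_le_iff_le_toReal hQtop).1 h2
    linarith
  calc _ ≤ volume (Icc (u x) (u x + (Q * ENNReal.ofReal δ).toReal)) := measure_mono hsub
    _ = _ := by rw [Real.volume_Icc, add_sub_cancel_left, ENNReal.ofReal_toReal hQtop]

theorem limsup_slope_le_gradMod (u : Ω → ℝ) (x : Ω) {δ : ℕ → ℝ} (hδ : Tendsto δ atTop (𝓝 0)) :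
    limsup (fun n => ⨆ y ∈ Metric.ball x (δ n) ∩ {x}ᶜ, ENNReal.ofReal (|u x - u y| / dist x y))
      atTop ≤ gradMod u x := by
  rw [gradMod_eq_iInf]
  refine le_iInf fun m => limsup_le_of_le (by isBoundedDefault) ?_
  have hm : (0 : ℝ) < 1 / ((m : ℝ) + 1) := by positivity
  filter_upwards [hδ.eventually (gt_mem_nhds hm)] with n hn
  exact biSup_mono fun y hy => ⟨Metric.ball_subset_ball hn.le hy.1, hy.2⟩

variable [MeasurableSpace Ω]

theorem perimeter_le_liminf (μ : Measure Ω) (A : Set Ω) {δ : ℕ → ℝ}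
    (hδ : Tendsto δ atTop (𝓝[>] 0)) :
    perimeter μ A ≤
      liminf (fun n => (μ (Metric.thickening (δ n) A) - μ A) / ENNReal.ofReal (δ n)) atTop :=
  liminf_le_liminf_of_le hδ (by isBoundedDefault) (by isBoundedDefault)

variable [BorelSpace Ω]

/-- The coarea inequality on the levels `[s₁, s₂]`. -/
theorem lintegral_perimeter_le {μ : Measure Ω} [SFinite μ] {u : Ω → ℝ} {K : ℝ≥0}
    (hu : LipschitzWith K u) (hfin : ∀ r, 0 < r → μ {x | r < u x} < ∞) {s₁ : ℝ} (s₂ : ℝ)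
    (hs : 0 < s₁) :
    ∫⁻ r in Icc s₁ s₂, perimeter μ {x | r < u x} ≤
      ∫⁻ x in {x | s₁ ≤ u x ∧ u x ≤ s₂}, gradMod u x ∂μ := by
  have hK : (0 : ℝ) ≤ K := K.2
  -- At scales `δ ≤ c` the function `u` varies by at most `K δ ≤ s₁ / 2`, so only points with `u x >
  -- s₁ / 3` contribute. They form a set of finite measure, which supplies the dominating function
  -- for the reverse Fatou lemma.
  set c : ℝ := s₁ / (2 * (K + 1)) with hc
  have hcpos : 0 < c := by positivity
  have hKc : K * c ≤ s₁ / 2 := by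
    have : (K + 1 : ℝ) * c = s₁ / 2 := by rw [hc]; field_simp
    nlinarith
  set δ : ℕ → ℝ := fun n => c * (1 / ((n : ℝ) + 1)) with hδdef
  have hδpos : ∀ n, 0 < δ n := fun n => by positivity
  have hδc : ∀ n, δ n ≤ c := fun n => by
    have : 1 / ((n : ℝ) + 1) ≤ 1 := by
      rw [div_le_one (by positivity)]; linarith [n.cast_nonneg (α := ℝ)]
    exact mul_le_of_le_one_right hcpos.le this
  have hδ0 : Tendsto δ atTop (𝓝 0) := by
    simpa [hδdef] using (tendsto_one_div_add_atTop_nhds_zero_nat (𝕜 := ℝ)).const_mul c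
  have hδ : Tendsto δ atTop (𝓝[>] 0) :=
    tendsto_nhdsWithin_iff.2 ⟨hδ0, Eventually.of_forall hδpos⟩
  -- For `r ∈ [s₁, s₂]` the slice at level `r` is the shell whose measure defines the perimeter; the
  -- slice at `x` is controlled by `volume_levels_le`. Tonelli exchanges the two, between Fatou in
  -- `r` and reverse Fatou in `x`.
  set S : ℕ → Set (Ω × ℝ) := fun n =>
    {p | u p.1 ≤ p.2} ∩ {p | p.1 ∈ Metric.thickening (δ n) {y | p.2 < u y}} ∩
      {p | p.2 ∈ Icc s₁ s₂} with hSdef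
  have hSmeas : ∀ n, MeasurableSet (S n) := fun n => by
    refine MeasurableSet.inter (MeasurableSet.inter ?_ ?_) (measurable_snd measurableSet_Icc)
    · exact measurableSet_le (hu.continuous.measurable.comp measurable_fst) measurable_snd
    · refine IsOpen.measurableSet ?_
      have : {p : Ω × ℝ | p.1 ∈ Metric.thickening (δ n) {y | p.2 < u y}} =
          ⋃ y, {p : Ω × ℝ | p.2 < u y} ∩ {p : Ω × ℝ | dist p.1 y < δ n} := by
        ext p
        simp only [mem_ofPred_eq, Metric.mem_thickening_iff, mem_iUnion, mem_inter_iff]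
      rw [this]
      exact isOpen_iUnion fun y => (isOpen_lt continuous_snd continuous_const).inter
        (isOpen_lt (by fun_prop) continuous_const)
  set H : ℕ → Ω → ℝ≥0∞ := fun n x => volume (Prod.mk x ⁻¹' S n) / ENNReal.ofReal (δ n) with hH
  have hHmeas : ∀ n, Measurable (H n) := fun n =>
    (measurable_measure_prodMk_left (hSmeas n)).div_const _
  have hHle : ∀ n x, H n x ≤ ⨆ y ∈ Metric.ball x (δ n) ∩ {x}ᶜ,
      ENNReal.ofReal (|u x - u y| / dist x y) := fun n x => by
    refine ENNReal.div_le_of_le_mul (le_trans (measure_mono ?_) (volume_levels_le hu x (δ n)))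
    exact fun r hr => hr.1
  have hempty : ∀ n x, (u x + K * δ n < s₁ ∨ s₂ < u x) → H n x = 0 := fun n x hx => by
    have : Prod.mk x ⁻¹' S n = ∅ := by
      refine eq_empty_of_forall_notMem ?_
      rintro r ⟨⟨h1 : u x ≤ r, h2 : x ∈ Metric.thickening (δ n) {y | r < u y}⟩,
        h3 : s₁ ≤ r, h4 : r ≤ s₂⟩
      obtain ⟨y, hy : r < u y, hxy⟩ := Metric.mem_thickening_iff.1 h2
      have h5 : u y - u x ≤ K * dist x y := by
        have := hu.dist_le_mul y x
        rw [Real.dist_eq, dist_comm] at this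
        exact (le_abs_self _).trans this
      have h6 : K * dist x y ≤ K * δ n := mul_le_mul_of_nonneg_left hxy.le hK
      rcases hx with hx | hx <;> linarith
    simp [hH, this]
  calc ∫⁻ r in Icc s₁ s₂, perimeter μ {x | r < u x}
      ≤ ∫⁻ r in Icc s₁ s₂, liminf (fun n => μ ((fun x => (x, r)) ⁻¹' S n) /
          ENNReal.ofReal (δ n)) atTop := by
        refine setLIntegral_mono' measurableSet_Icc fun r hr => ?_
        refine (perimeter_le_liminf μ _ hδ).trans (le_of_eq ?_)
        congr 1
        ext n
        congr 1
        have hA : MeasurableSet {x | r < u x} :=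
          measurableSet_lt measurable_const hu.continuous.measurable
        rw [← measure_sdiff (Metric.self_subset_thickening (hδpos n) _) hA.nullMeasurableSet
          (hfin r (hs.trans_le hr.1)).ne]
        congr 1
        ext x
        simp only [Set.mem_sdiff, mem_ofPred_eq, not_lt, hSdef, mem_preimage, mem_inter_iff, hr,
          and_true]
        tauto
    _ ≤ liminf (fun n => ∫⁻ r in Icc s₁ s₂, μ ((fun x => (x, r)) ⁻¹' S n) /
          ENNReal.ofReal (δ n)) atTop :=
        lintegral_liminf_le fun n => (measurable_measure_prodMk_right (hSmeas n)).div_const _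
    _ ≤ liminf (fun n => ∫⁻ x, H n x ∂μ) atTop := by
        refine liminf_le_liminf (Eventually.of_forall fun n => ?_)
          (by isBoundedDefault) (by isBoundedDefault)
        refine (setLIntegral_le_lintegral _ _).trans ?_
        simp only [hH, div_eq_mul_inv]
        rw [lintegral_mul_const _ (measurable_measure_prodMk_right (hSmeas n)),
          lintegral_mul_const _ (measurable_measure_prodMk_left (hSmeas n)),
          ← Measure.prod_apply (hSmeas n), ← Measure.prod_apply_symm (hSmeas n)]
    _ ≤ limsup (fun n => ∫⁻ x, H n x ∂μ) atTop := liminf_le_limsup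
    _ ≤ ∫⁻ x, limsup (fun n => H n x) atTop ∂μ := by
        have hm : MeasurableSet {x | s₁ / 3 < u x} :=
          measurableSet_lt measurable_const hu.continuous.measurable
        refine limsup_lintegral_le ({x | s₁ / 3 < u x}.indicator fun _ => (K : ℝ≥0∞)) hHmeas
          (fun n => Eventually.of_forall fun x => ?_) ?_
        · by_cases hx : s₁ / 3 < u x
          · rw [indicator_of_mem (by exact hx)]
            exact (hHle n x).trans (iSup₂_le fun y _ => ofReal_slope_le hu x y)
          · rw [hempty n x (Or.inl ?_)]
            · exact zero_le
            · have := mul_le_mul_of_nonneg_left (hδc n) hK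
              linarith [not_lt.1 hx]
        · rw [lintegral_indicator_const hm]
          exact ENNReal.mul_ne_top ENNReal.coe_ne_top (hfin _ (by positivity)).ne
    _ ≤ ∫⁻ x, {x | s₁ ≤ u x ∧ u x ≤ s₂}.indicator (gradMod u) x ∂μ := by
        refine lintegral_mono fun x => ?_
        dsimp only
        by_cases hx : s₁ ≤ u x ∧ u x ≤ s₂
        · rw [indicator_of_mem (by exact hx)]
          exact (limsup_le_limsup (Eventually.of_forall fun n => hHle n x)
            (by isBoundedDefault) (by isBoundedDefault)).trans (limsup_slope_le_gradMod u x hδ0)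
        · rw [indicator_of_notMem (by exact hx)]
          refine limsup_le_of_le (by isBoundedDefault) ?_
          rw [not_and_or, not_le, not_le] at hx
          rcases hx with hx | hx
          · have hlim : Tendsto (fun n => u x + K * δ n) atTop (𝓝 (u x)) := by
              simpa using (hδ0.const_mul (K : ℝ)).const_add (u x)
            filter_upwards [hlim.eventually (gt_mem_nhds hx)] with n hn
            exact (hempty n x (Or.inl hn)).le
          · exact Eventually.of_forall fun n => (hempty n x (Or.inr hx)).le
    _ = ∫⁻ x in {x | s₁ ≤ u x ∧ u x ≤ s₂}, gradMod u x ∂μ :=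
        lintegral_indicator ((measurableSet_le measurable_const hu.continuous.measurable).inter
          (measurableSet_le hu.continuous.measurable measurable_const)) _

end Metric

/-! ### Transport of `μ` by the distribution function. -/

/-- Lebesgue outer measure is the largest outer measure bounded by length on intervals. -/
theorem measure_le_volume_of_Ioc {κ : Measure ℝ}
    (h : ∀ a b, κ (Ioc a b) ≤ ENNReal.ofReal (b - a)) : κ ≤ volume := by
  have hκ : κ.toOuterMeasure ≤ StieltjesFunction.id.outer := by
    refine OuterMeasure.le_ofFunction.2 fun s => ?_
    rw [StieltjesFunction.length_eq]
    refine le_iInf₂ fun a b => le_iInf fun hs => ?_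
    refine le_trans (measure_mono ?_) (h a b)
    exact fun x hx => hs ⟨hx, fun hx' => not_isBot x hx'⟩
  refine Measure.le_iff.2 fun s hs => ?_
  rw [Real.volume_eq_stieltjes_id]
  rw [StieltjesFunction.measure]
  exact hκ s

section Levels

variable {α : Type*} [MeasurableSpace α] {μ : Measure α}

/-- The condition on `distrib` says `v*(b) ≤ v x < v*(a)`. The open strip has measure at most `b -
a`; the level `v*(b)` itself could spoil this only if it had positive measure, and then it is
excluded. -/
theorem measure_distrib_mem_Ioc_le {v : α → ℝ≥0∞} (hv : Measurable v) {a b : ℝ}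
    (ha : 0 ≤ a) :
    μ {x | μ {y | v y = v x} = 0 ∧ ENNReal.ofReal a < distrib μ v (v x) ∧
      distrib μ v (v x) ≤ ENNReal.ofReal b} ≤ ENNReal.ofReal (b - a) := by
  set p := rearr μ v b with hp
  set q := rearr μ v a with hq
  have h1 : μ {x | p < v x ∧ v x < q} ≤ ENNReal.ofReal (b - a) := by
    rcases le_or_gt q p with hqp | hpq
    · have : {x | p < v x ∧ v x < q} = ∅ :=
        eq_empty_of_forall_notMem fun x hx => absurd (hx.1.trans hx.2) (not_lt.2 hqp)
      simp [this]
    -- The strip is exhausted from below because `distrib` exceeds `a` only strictly below `q`.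
    obtain ⟨w, hw, hwmem, hwlim⟩ := exists_seq_strictMono_tendsto' hpq
    have hU : {x | p < v x ∧ v x < q} = ⋃ n, {x | p < v x ∧ v x ≤ w n} := by
      ext x
      simp only [mem_ofPred_eq, mem_iUnion]
      constructor
      · rintro ⟨hx, hx'⟩
        obtain ⟨n, hn⟩ := (hwlim.eventually (lt_mem_nhds hx')).exists
        exact ⟨n, hx, hn.le⟩
      · rintro ⟨n, hn, hn'⟩
        exact ⟨hn, hn'.trans_lt (hwmem n).2⟩
    rw [hU, Monotone.measure_iUnion (s := fun n => {x | p < v x ∧ v x ≤ w n})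
      fun m n hmn x hx => ⟨hx.1, hx.2.trans (hw.monotone hmn)⟩]
    refine iSup_le fun n => ?_
    have hdp : distrib μ v p ≤ ENNReal.ofReal b := rearr_le_iff.1 le_rfl
    have hdw : ENNReal.ofReal a < distrib μ v (w n) := lt_rearr_iff.1 (hwmem n).2
    have hsub : {x | w n < v x} ⊆ {x | p < v x} := fun x hx => (hwmem n).1.trans hx
    have hdiff : {x | p < v x ∧ v x ≤ w n} = {x | p < v x} \ {x | w n < v x} := by
      ext x; simp
    have hwfin : distrib μ v (w n) ≠ ∞ :=
      ne_top_of_le_ne_top ENNReal.ofReal_ne_top ((measure_mono hsub).trans hdp)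
    rw [hdiff, measure_sdiff hsub (measurableSet_lt measurable_const hv).nullMeasurableSet hwfin,
      ENNReal.ofReal_sub _ ha]
    exact tsub_le_tsub hdp hdw.le
  by_cases h0 : μ {y | v y = p} = 0
  · refine le_trans (measure_mono ?_) ((measure_union_le _ _).trans
      ((add_le_of_nonpos_left h0.le).trans h1))
    rintro x ⟨-, hx1, hx2⟩
    rcases (rearr_le_iff.2 hx2).lt_or_eq with h | h
    · exact Or.inr ⟨h, lt_rearr_iff.2 hx1⟩
    · exact Or.inl h.symm
  · refine le_trans (measure_mono ?_) h1
    rintro x ⟨hx0, hx1, hx2⟩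
    refine ⟨(rearr_le_iff.2 hx2).lt_of_ne ?_, lt_rearr_iff.2 hx1⟩
    rintro h
    exact h0 (by rw [hp, h]; exact hx0)

theorem measure_distrib_mem_le [SFinite μ] {v : α → ℝ≥0∞} (hv : Measurable v)
    {E : Set ℝ} (hE : MeasurableSet E) (hE0 : E ⊆ Ioi 0) :
    μ {x | μ {y | v y = v x} = 0 ∧ (distrib μ v (v x)).toReal ∈ E} ≤ volume E := by
  have hN : MeasurableSet {x | μ {y | v y = v x} = 0} := by
    have : {x | μ {y | v y = v x} = 0} = v ⁻¹' {t | 0 < μ {y | v y = t}}ᶜ := by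
      ext x; simp
    rw [this]
    exact hv (Measure.countable_meas_level_set_pos hv).measurableSet.compl
  have hd : Measurable fun x => (distrib μ v (v x)).toReal :=
    ((distrib_antitone μ v).measurable.comp hv).ennreal_toReal
  -- Restricting to `(0, ∞)` also discards the points where `distrib` is infinite, since `toReal`
  -- sends `∞` to `0`.
  set κ : Measure ℝ := ((μ.restrict {x | μ {y | v y = v x} = 0}).map
    fun x => (distrib μ v (v x)).toReal).restrict (Ioi 0) with hκ
  have hκv : κ ≤ volume := by
    refine measure_le_volume_of_Ioc fun a b => ?_
    rw [hκ, Measure.restrict_apply measurableSet_Ioc,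
      Measure.map_apply hd (measurableSet_Ioc.inter measurableSet_Ioi),
      Measure.restrict_apply (hd (measurableSet_Ioc.inter measurableSet_Ioi))]
    refine (measure_mono ?_).trans ((measure_distrib_mem_Ioc_le (μ := μ) hv
      (le_max_right a 0) (b := b)).trans (ENNReal.ofReal_le_ofReal (by gcongr; exact le_max_left _ _)))
    rintro x ⟨⟨⟨h1, h2⟩, h3⟩, h4⟩
    simp only [mem_Ioi] at h1 h2 h3
    have hne : distrib μ v (v x) ≠ ∞ := fun h => by simp [h] at h3
    exact ⟨h4, (ENNReal.ofReal_lt_iff_lt_toReal (le_max_right _ _) hne).2 (max_lt h1 h3),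
      ENNReal.le_ofReal_iff_toReal_le hne (h3.le.trans h2) |>.2 h2⟩
  refine le_trans (le_of_eq ?_) (hκv E)
  rw [hκ, Measure.restrict_apply hE, inter_eq_self_of_subset_left hE0,
    Measure.map_apply hd hE, Measure.restrict_apply (hd hE)]
  congr 1
  ext x
  exact and_comm

end Levels

/-! ### Levels of a real function. -/

section RealDistrib

variable {α : Type*} [MeasurableSpace α] {μ : Measure α}

theorem distrib_enorm (μ : Measure α) (f : α → ℝ) {r : ℝ} (hr : 0 ≤ r) :
    distrib μ (fun x => ‖f x‖ₑ) (ENNReal.ofReal r) = μ {x | r < |f x|} := by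
  rw [distrib]
  congr 1
  ext x
  simp only [mem_ofPred_eq]
  rw [← ofReal_norm, ENNReal.ofReal_lt_ofReal_iff_of_nonneg hr, Real.norm_eq_abs]

/-- The distribution function of `|f|`, as a real function of a real level. -/
noncomputable def realDistrib (μ : Measure α) (f : α → ℝ) (r : ℝ) : ℝ :=
  (distrib μ (fun x => ‖f x‖ₑ) (ENNReal.ofReal r)).toReal

theorem distrib_ne_top {f : α → ℝ} (h0 : distrib μ (fun x => ‖f x‖ₑ) 0 ≠ ∞) (q : ℝ≥0∞) :
    distrib μ (fun x => ‖f x‖ₑ) q ≠ ∞ :=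
  ne_top_of_le_ne_top h0 (distrib_antitone μ _ zero_le)

theorem measurable_realDistrib (μ : Measure α) (f : α → ℝ) : Measurable (realDistrib μ f) :=
  ((distrib_antitone μ _).measurable.comp ENNReal.measurable_ofReal).ennreal_toReal

theorem rearr_eq_volume {f : α → ℝ} (h0 : distrib μ (fun x => ‖f x‖ₑ) 0 ≠ ∞) {t : ℝ}
    (ht : 0 ≤ t) :
    rearr μ (fun x => ‖f x‖ₑ) t = volume {r : ℝ | 0 < r ∧ t < realDistrib μ f r} := by
  rw [← volume_ofReal_lt (rearr μ (fun x => ‖f x‖ₑ) t)]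
  congr 1
  ext r
  simp only [mem_ofPred_eq, lt_rearr_iff, realDistrib]
  rw [ENNReal.ofReal_lt_iff_lt_toReal ht (distrib_ne_top h0 _)]

end RealDistrib

/-! ### Isoperimetry on sets of levels. -/

section RearrangedGradient

variable {Ω : Type*} [MetricSpace Ω] [MeasurableSpace Ω] {μ : Measure Ω} {I : ℝ → ℝ}

theorem IsIsoperimetricEstimator.measurable_indicator (hI : IsIsoperimetricEstimator μ I) :
    Measurable ({t : ℝ | 0 < t ∧ ENNReal.ofReal t < μ univ}.indicator
      fun t => ENNReal.ofReal (I t)) := by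
  have hc : ContinuousOn (fun t => ENNReal.ofReal (I t))
      {t : ℝ | 0 < t ∧ ENNReal.ofReal t < μ univ} :=
    ENNReal.continuous_ofReal.comp_continuousOn
      (hI.continuous.mono fun t ht => ⟨ht.1.le, ht.2⟩)
  rw [← piecewise_eq_indicator]
  exact hc.measurable_piecewise continuousOn_const (measurableSet_ofReal_lt _)

/-- A concave nonnegative function vanishing at an interior point vanishes identically. -/
theorem IsIsoperimetricEstimator.eq_zero_or_pos (hI : IsIsoperimetricEstimator μ I) :
    (∀ t, 0 < t → ENNReal.ofReal t < μ univ → I t = 0) ∨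
      ∀ t, 0 < t → ENNReal.ofReal t < μ univ → 0 < I t := by
  by_contra! h
  obtain ⟨⟨b, hb0, hbM, hb⟩, a, ha0, haM, ha⟩ := h
  have ha' : I a = 0 := le_antisymm ha (hI.nonneg a ha0.le haM)
  have hb' : 0 < I b := lt_of_le_of_ne (hI.nonneg b hb0.le hbM) (Ne.symm hb)
  have hmem0 : (0 : ℝ) ∈ {t : ℝ | 0 ≤ t ∧ ENNReal.ofReal t < μ univ} :=
    ⟨le_rfl, by simpa using (zero_le.trans_lt haM)⟩
  -- If `a` lies strictly between `b` and `c`, concavity gives `I a` at least a positive multiple of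
  -- `I b`. The point `c` is `0` when `a < b`, and a point just right of `a` otherwise.
  have key : ∀ c, c ∈ {t : ℝ | 0 ≤ t ∧ ENNReal.ofReal t < μ univ} →
      a ∈ openSegment ℝ b c → False := by
    rintro c hc ⟨x, y, hx, hy, hxy, rfl⟩
    have h1 := hI.concave.2 ⟨hb0.le, hbM⟩ hc hx.le hy.le hxy
    have h2 := hI.nonneg c hc.1 hc.2
    simp only [smul_eq_mul] at h1 ha'
    have := mul_pos hx hb'
    have := mul_nonneg hy.le h2
    linarith
  rcases lt_trichotomy a b with hab | hab | hab
  · refine key 0 hmem0 ?_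
    rw [openSegment_symm, openSegment_eq_Ioo hb0]
    exact ⟨ha0, hab⟩
  · rw [hab] at ha'
    exact hb ha'
  · obtain ⟨c, hac, hcM⟩ : ∃ c, a < c ∧ ENNReal.ofReal c < μ univ := by
      have hlim : Tendsto ENNReal.ofReal (𝓝[>] a) (𝓝 (ENNReal.ofReal a)) :=
        ENNReal.continuous_ofReal.continuousAt.tendsto.mono_left nhdsWithin_le_nhds
      have hmem : ∀ᶠ c in 𝓝[>] a, a < c := self_mem_nhdsWithin
      exact (hmem.and (hlim.eventually (gt_mem_nhds haM))).exists
    refine key c ⟨(ha0.trans hac).le, hcM⟩ ?_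
    rw [openSegment_eq_Ioo (hab.trans hac)]
    exact ⟨hab, hac⟩

variable [BorelSpace Ω]

/-- The coarea inequality gives this for intervals of levels; since both sides are measures in `B`,
differentiation along a Vitali family extends it to Borel sets. -/
theorem lintegral_levels_le [SFinite μ] (hI : IsIsoperimetricEstimator μ I) {f : Ω → ℝ} {K : ℝ≥0}
    (hf : LipschitzWith K f) (h0 : distrib μ (fun x => ‖f x‖ₑ) 0 ≠ ∞)
    (hG : ∫⁻ x, gradMod f x ∂μ ≠ ∞) {B : Set ℝ} (hB : MeasurableSet B) (hB0 : B ⊆ Ioi 0) :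
    ∫⁻ r in B, {t : ℝ | 0 < t ∧ ENNReal.ofReal t < μ univ}.indicator
        (fun t => ENNReal.ofReal (I t)) (realDistrib μ f r) ≤
      ∫⁻ x in {x | |f x| ∈ B}, gradMod f x ∂μ := by
  set W := {t : ℝ | 0 < t ∧ ENNReal.ofReal t < μ univ}.indicator
    (fun t => ENNReal.ofReal (I t)) with hW
  have hfm : Measurable fun x => |f x| := hf.continuous.abs.measurable
  have hu : LipschitzWith K fun x => |f x| := by
    have h := (lipschitzWith_one_norm (E := ℝ)).comp hf
    rw [one_mul] at h
    exact h
  set η : Measure ℝ := (μ.withDensity (gradMod f)).map fun x => |f x| with hη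
  have : IsFiniteMeasure (μ.withDensity (gradMod f)) := isFiniteMeasure_withDensity hG
  have hWle : ∀ r, 0 < r → W (realDistrib μ f r) ≤ perimeter μ {x | r < |f x|} := by
    intro r hr
    by_cases hm : realDistrib μ f r ∈ {t : ℝ | 0 < t ∧ ENNReal.ofReal t < μ univ}
    · rw [hW, indicator_of_mem hm]
      refine (hI.le_profile _ hm.1.le hm.2).trans ?_
      refine iInf₂_le_of_le {x | r < |f x|} (measurableSet_lt measurable_const hfm)
        (iInf_le_of_le ?_ le_rfl)
      rw [realDistrib, ENNReal.ofReal_toReal (distrib_ne_top h0 _), distrib_enorm μ f hr.le]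
    · rw [hW, indicator_of_notMem hm]
      exact zero_le
  have hmain := VitaliFamily.measure_le_of_frequently_le
    (v := IsUnifLocDoublingMeasure.vitaliFamily (volume : Measure ℝ) 1) η
    (withDensity_absolutelyContinuous volume fun r => W (realDistrib μ f r)) B fun x hx => by
      refine (Real.tendsto_Icc_vitaliFamily_right x).frequently (Eventually.frequently ?_)
      refine Eventually.of_forall fun y => ?_
      rw [withDensity_apply _ measurableSet_Icc, hη, Measure.map_apply hfm measurableSet_Icc,
        withDensity_apply _ (hfm measurableSet_Icc)]
      have hx0 : 0 < x := hB0 hx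
      calc _ ≤ ∫⁻ r in Icc x y, perimeter μ {x | r < |f x|} :=
            setLIntegral_mono' measurableSet_Icc fun r hr => hWle r (hx0.trans_le hr.1)
        _ ≤ ∫⁻ z in {z | x ≤ |f z| ∧ |f z| ≤ y}, gradMod (fun w => |f w|) z ∂μ := by
            refine lintegral_perimeter_le hu (fun r hr => ?_) y hx0
            rw [← distrib_enorm μ f hr.le]
            exact (distrib_ne_top h0 _).lt_top
        _ ≤ _ := lintegral_mono fun z => gradMod_abs_le f z
  rwa [withDensity_apply _ hB, hη, Measure.map_apply hfm hB, withDensity_apply _ (hfm hB)] at hmain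

/-- `G` consists of the points whose value `|f x|` is a level with `λ ∈ E`, minus the level sets of
positive measure. The latter occupy countably many levels, hence do not affect the integral in `r`,
but would destroy the bound on `μ G`. -/
theorem exists_measure_le_lintegral_le [SFinite μ] (hI : IsIsoperimetricEstimator μ I) {f : Ω → ℝ}
    {K : ℝ≥0} (hf : LipschitzWith K f) (h0 : distrib μ (fun x => ‖f x‖ₑ) 0 ≠ ∞)
    (hG : ∫⁻ x, gradMod f x ∂μ ≠ ∞) {E : Set ℝ} (hE : MeasurableSet E) (hE0 : E ⊆ Ioi 0) :
    ∃ G : Set Ω, MeasurableSet G ∧ μ G ≤ volume E ∧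
      ∫⁻ r in {r : ℝ | 0 < r ∧ realDistrib μ f r ∈ E},
        {t : ℝ | 0 < t ∧ ENNReal.ofReal t < μ univ}.indicator
          (fun t => ENNReal.ofReal (I t)) (realDistrib μ f r) ≤
      ∫⁻ x in G, gradMod f x ∂μ := by
  have hfm : Measurable fun x => |f x| := hf.continuous.abs.measurable
  have hA : {r : ℝ | 0 < μ {y | |f y| = r}}.Countable := Measure.countable_meas_level_set_pos hfm
  set B : Set ℝ := {r : ℝ | 0 < r ∧ realDistrib μ f r ∈ E} \ {r : ℝ | 0 < μ {y | |f y| = r}}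
  have hS : MeasurableSet {r : ℝ | 0 < r ∧ realDistrib μ f r ∈ E} :=
    measurableSet_Ioi.inter (measurable_realDistrib μ f hE)
  have hB : MeasurableSet B := hS.diff hA.measurableSet
  refine ⟨{x | |f x| ∈ B}, hfm hB, ?_, ?_⟩
  · refine (measure_mono ?_).trans (measure_distrib_mem_le (μ := μ) (v := fun x => ‖f x‖ₑ)
      hf.continuous.measurable.enorm hE hE0)
    rintro x ⟨⟨h1, h2⟩, h3⟩
    have hx : ENNReal.ofReal |f x| = ‖f x‖ₑ := by rw [← Real.norm_eq_abs, ofReal_norm]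
    refine ⟨?_, ?_⟩
    · have h4 : μ {y | |f y| = |f x|} = 0 := by simpa using h3
      rw [← h4]
      congr 1
      ext y
      simp only [mem_ofPred_eq]
      rw [← ofReal_norm, ← ofReal_norm, ENNReal.ofReal_eq_ofReal_iff
        (norm_nonneg _) (norm_nonneg _), Real.norm_eq_abs, Real.norm_eq_abs]
    · rw [realDistrib, hx] at h2
      exact h2
  · refine le_trans (le_of_eq ?_) (lintegral_levels_le hI hf h0 hG hB fun r hr => hr.1.1)
    exact (setLIntegral_congr (sdiff_null_ae_eq_self (hA.measure_zero _))).symm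

end RearrangedGradient

/-! ### Density of the rearrangement and its domination by the gradient. -/

section Density

variable {Ω : Type*} [MetricSpace Ω] [MeasurableSpace Ω] {μ : Measure Ω} {I : ℝ → ℝ}

theorem aemeasurable_ofReal_div (hI : IsIsoperimetricEstimator μ I) :
    AEMeasurable (fun t => ENNReal.ofReal (I t / t)) (intervalMeasure (μ univ)) := by
  have : ContinuousOn (fun t => ENNReal.ofReal (I t / t))
      {t : ℝ | 0 < t ∧ ENNReal.ofReal t < μ univ} :=
    ENNReal.continuous_ofReal.comp_continuousOn
      ((hI.continuous.mono fun t ht => ⟨ht.1.le, ht.2⟩).div continuousOn_id fun t ht => ht.1.ne')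
  exact this.aemeasurable (measurableSet_ofReal_lt _)

theorem aemeasurable_hardyOp (hI : IsIsoperimetricEstimator μ I) (g : ℝ → ℝ≥0∞) :
    AEMeasurable (hardyOp (μ univ) I g) (intervalMeasure (μ univ)) := by
  refine (aemeasurable_ofReal_div hI).mul (Antitone.measurable ?_).aemeasurable
  exact fun s t hst => lintegral_mono_set fun x hx => ⟨hst.trans_lt hx.1, hx.2⟩

variable [BorelSpace Ω]

/-- The decreasing rearrangement of a Lipschitz function is locally absolutely continuous, with a
density `ψ` such that `I ψ` is dominated by the modulus of the gradient. -/
theorem exists_rearr_density [SFinite μ] (hI : IsIsoperimetricEstimator μ I)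
    (hpos : ∀ t, 0 < t → ENNReal.ofReal t < μ univ → 0 < I t) {f : Ω → ℝ}
    {K : ℝ≥0} (hf : LipschitzWith K f) (h0 : distrib μ (fun x => ‖f x‖ₑ) 0 ≠ ∞)
    (hG : ∫⁻ x, gradMod f x ∂μ ≠ ∞) :
    ∃ ψ : ℝ → ℝ≥0∞, Measurable ψ ∧
      (∀ E, MeasurableSet E → E ⊆ {t : ℝ | 0 < t ∧ ENNReal.ofReal t < μ univ} →
        volume {r : ℝ | 0 < r ∧ realDistrib μ f r ∈ E} = ∫⁻ s in E, ψ s) ∧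
      ∀ q, ∫⁻ t, ({t : ℝ | 0 < t ∧ ENNReal.ofReal t < μ univ}.indicator
          (fun t => ENNReal.ofReal (I t)) t * ψ t - q) ∂intervalMeasure (μ univ) ≤
        ∫⁻ x, (gradMod f x - q) ∂μ := by
  set J : Set ℝ := {t : ℝ | 0 < t ∧ ENNReal.ofReal t < μ univ} with hJ
  have hJm : MeasurableSet J := measurableSet_ofReal_lt _
  set W : ℝ → ℝ≥0∞ := J.indicator (fun t => ENNReal.ofReal (I t)) with hW
  have hWm : Measurable W := hI.measurable_indicator
  have hlam := measurable_realDistrib μ f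
  set η : Measure ℝ := (volume.restrict (Ioi (0 : ℝ))).map (realDistrib μ f) with hη
  have hηE : ∀ E, MeasurableSet E → η E = volume {r : ℝ | 0 < r ∧ realDistrib μ f r ∈ E} := by
    intro E hE
    rw [hη, Measure.map_apply hlam hE, Measure.restrict_apply (hlam hE), inter_comm]
    rfl
  have hJ0 : J ⊆ Ioi 0 := fun t ht => ht.1
  -- For a null set `E` the set `G` is null, so `I(λ(r))` integrates to zero over the levels with
  -- `λ(r) ∈ E`; as `I > 0` there, these levels form a null set.
  have hac : η.restrict J ≪ volume := by
    refine Measure.AbsolutelyContinuous.mk fun E hE hE0 => ?_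
    rw [Measure.restrict_apply hE, hηE _ (hE.inter hJm)]
    obtain ⟨G, hGm, hGE, hle⟩ := exists_measure_le_lintegral_le hI hf h0 hG (hE.inter hJm)
      (inter_subset_right.trans hJ0)
    have hG0 : μ G = 0 :=
      le_antisymm (hGE.trans ((measure_mono inter_subset_left).trans hE0.le)) zero_le
    rw [Measure.restrict_eq_zero.2 hG0, lintegral_zero_measure] at hle
    by_contra hne
    refine absurd hle (not_le.2 ((setLIntegral_pos_iff (hWm.comp hlam)).2 ?_))
    refine (pos_iff_ne_zero.2 hne).trans_le (measure_mono fun r hr => ⟨?_, hr⟩)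
    have hrJ : realDistrib μ f r ∈ J := hr.2.2
    simp only [Function.mem_support, Function.comp_apply, hW, indicator_of_mem hrJ]
    exact (ENNReal.ofReal_pos.2 (hpos _ hrJ.1 hrJ.2)).ne'
  have hψm : Measurable ((η.restrict J).rnDeriv volume) := Measure.measurable_rnDeriv _ _
  have hψ := Measure.withDensity_rnDeriv_eq (η.restrict J) volume hac
  set ψ := (η.restrict J).rnDeriv volume
  refine ⟨ψ, hψm, fun E hE hEJ => ?_, fun q => ?_⟩
  · rw [← hηE E hE, ← withDensity_apply _ hE, hψ, Measure.restrict_apply hE,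
      inter_eq_self_of_subset_left hEJ]
  rcases eq_or_ne q ∞ with rfl | hq
  · simp
  have hle : ∀ E, MeasurableSet E → E ⊆ J → ∃ G : Set Ω, MeasurableSet G ∧ μ G ≤ volume E ∧
      ∫⁻ t in E, W t * ψ t ≤ ∫⁻ x in G, gradMod f x ∂μ := by
    intro E hE hEJ
    obtain ⟨G, hGm, hGE, hle⟩ := exists_measure_le_lintegral_le hI hf h0 hG hE (hEJ.trans hJ0)
    refine ⟨G, hGm, hGE, le_trans (le_of_eq ?_) hle⟩
    have h1 : ∫⁻ t in E, W t * ψ t = ∫⁻ t in E, W t ∂(volume.withDensity ψ) := by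
      rw [setLIntegral_withDensity_eq_setLIntegral_mul _ hψm hWm hE]
      exact lintegral_congr fun t => mul_comm _ _
    rw [h1, hψ, Measure.restrict_restrict hE, inter_eq_self_of_subset_left hEJ, hη,
      setLIntegral_map hE hWm hlam, Measure.restrict_restrict (hlam hE), inter_comm]
    rfl
  set φ : ℝ → ℝ≥0∞ := fun t => W t * ψ t with hφ
  have hφm : Measurable φ := hWm.mul hψm
  -- The superlevel set of `φ` carries all of `(φ - q)₊`. Cutting it at `n` makes `q * volume (E n)`
  -- finite, so this term can be cancelled against `q * μ G`.
  set E : ℕ → Set ℝ := fun n => J ∩ {t | q < φ t} ∩ Iic (n : ℝ) with hE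
  have hEm : ∀ n, MeasurableSet (E n) := fun n =>
    (hJm.inter (measurableSet_lt measurable_const hφm)).inter measurableSet_Iic
  have hEfin : ∀ n, volume (E n) ≠ ∞ := fun n => by
    refine ne_top_of_le_ne_top (measure_Icc_lt_top (a := (0 : ℝ)) (b := n)).ne (measure_mono ?_)
    exact fun t ht => ⟨ht.1.1.1.le, ht.2⟩
  have hEn : ∀ n, ∫⁻ t in E n, (φ t - q) ≤ ∫⁻ x, (gradMod f x - q) ∂μ := by
    intro n
    obtain ⟨G, hGm, hGE, hle⟩ := hle (E n) (hEm n) fun t ht => ht.1.1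
    have hfin : q * volume (E n) ≠ ∞ := ENNReal.mul_ne_top hq (hEfin n)
    refine (ENNReal.add_le_add_iff_right hfin).1 ?_
    calc (∫⁻ t in E n, (φ t - q)) + q * volume (E n) = ∫⁻ t in E n, (φ t - q + q) := by
          rw [lintegral_add_right _ measurable_const, setLIntegral_const]
      _ = ∫⁻ t in E n, φ t :=
          setLIntegral_congr_fun (hEm n) fun t ht => tsub_add_cancel_of_le (le_of_lt ht.1.2)
      _ ≤ ∫⁻ x in G, gradMod f x ∂μ := hle
      _ ≤ ∫⁻ x in G, (gradMod f x - q + q) ∂μ := lintegral_mono fun x => le_tsub_add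
      _ = ∫⁻ x in G, (gradMod f x - q) ∂μ + q * μ G := by
          rw [lintegral_add_right _ measurable_const, setLIntegral_const]
      _ ≤ _ := by
          gcongr
          exact Measure.restrict_le_self
  have hU : ∫⁻ t, (φ t - q) ∂intervalMeasure (μ univ) = ∫⁻ t in ⋃ n, E n, (φ t - q) := by
    have hUE : ⋃ n, E n = {t | q < φ t} ∩ J := by
      rw [hE, ← inter_iUnion, inter_comm J]
      refine inter_eq_self_of_subset_left fun t _ => mem_iUnion.2 ?_
      exact exists_nat_ge t
    rw [hUE, ← setLIntegral_indicator (measurableSet_lt measurable_const hφm), intervalMeasure]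
    refine lintegral_congr fun t => ?_
    by_cases ht : q < φ t
    · rw [indicator_of_mem (by exact ht)]
    · rw [indicator_of_notMem (by exact ht), tsub_eq_zero_of_le (not_lt.1 ht)]
  rw [hU, setLIntegral_iUnion_of_directed]
  · exact iSup_le hEn
  · refine Monotone.directed_le fun m n hmn => ?_
    exact inter_subset_inter_right _ (Iic_subset_Iic.2 (by exact_mod_cast hmn))

theorem norm_gradMod_lt_top (X : RINorm μ) {f : Ω → ℝ} {K : ℝ≥0} (hf : LipschitzWith K f)
    (hA : μ (tsupport f) < ∞) : X.norm (gradMod f) < ∞ := by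
  have hm : MeasurableSet (tsupport f) := (isClosed_tsupport f).measurableSet
  have h1 : AEMeasurable ((tsupport f).indicator fun _ => (1 : ℝ≥0∞)) μ :=
    aemeasurable_const.indicator hm
  refine (X.mono _ _ (measurable_gradMod hf.continuous).aemeasurable (h1.const_mul (K : ℝ≥0∞))
    (Eventually.of_forall (gradMod_le_indicator hf subset_rfl))).trans_lt ?_
  rw [X.smul K _ h1]
  exact ENNReal.mul_lt_top ENNReal.coe_lt_top (X.indicator_lt_top _ hm hA)

theorem lintegral_gradMod_lt_top {f : Ω → ℝ} {K : ℝ≥0} (hf : LipschitzWith K f)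
    (hA : μ (tsupport f) < ∞) : ∫⁻ x, gradMod f x ∂μ < ∞ := by
  have hm : MeasurableSet (tsupport f) := (isClosed_tsupport f).measurableSet
  refine (lintegral_mono (gradMod_le_indicator hf subset_rfl)).trans_lt ?_
  rw [lintegral_const_mul _ (measurable_const.indicator hm), lintegral_indicator hm,
    setLIntegral_one]
  exact ENNReal.mul_lt_top ENNReal.coe_lt_top hA

end Density

/-! ### The degenerate estimator and the value at half the mass. -/

section HalfMeasure

variable {α : Type*} [MeasurableSpace α] {μ : Measure α} {I : ℝ → ℝ}

theorem lt_of_lt_half {a b : ℝ≥0∞} (h : a < b / 2) : a < b := h.trans_le ENNReal.half_le_self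

theorem ofReal_half_toReal {M : ℝ≥0∞} (hM : M ≠ ∞) : ENNReal.ofReal (M.toReal / 2) = M / 2 := by
  rw [ENNReal.ofReal_div_of_pos two_pos, ENNReal.ofReal_toReal hM, ENNReal.ofReal_ofNat]

theorem bar_eq_zero_of_estimator_eq_zero (X : RINorm μ)
    (hz : ∀ t, 0 < t → ENNReal.ofReal t < μ univ → I t = 0) {h : ℝ → ℝ≥0∞}
    (hle : ∀ t, I t = 0 → h t = 0) : X.bar h = 0 := by
  refine le_antisymm (X.bar_zero ▸ X.bar_mono ?_) zero_le
  refine ae_restrict_of_forall_mem (measurableSet_ofReal_lt _) fun t ht => ?_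
  exact (hle t (hz t ht.1 ht.2)).le

/-- The value of the rearrangement at half the total mass is at most twice the mean. -/
theorem rearr_half_mul_le [SFinite μ] (hM : μ univ ≠ ∞) (h0 : μ univ ≠ 0) {v : α → ℝ≥0∞}
    (hv : AEMeasurable v μ) (k : ℝ≥0∞) :
    rearr μ v ((μ univ).toReal / 2) * k ≤ 2 * k / μ univ * ∫⁻ x, v x ∂μ := by
  set c := rearr μ v ((μ univ).toReal / 2)
  have h1 : c * (μ univ / 2) ≤ ∫⁻ x, v x ∂μ := by
    rw [← lintegral_rearr_top hv, ← ofReal_half_toReal hM]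
    calc c * ENNReal.ofReal ((μ univ).toReal / 2)
        = ∫⁻ _ in Ioc 0 ((μ univ).toReal / 2), c := by simp
      _ ≤ ∫⁻ s in Ioc 0 ((μ univ).toReal / 2), rearr μ v s :=
          setLIntegral_mono' measurableSet_Ioc fun s hs => rearr_antitone μ v hs.2
      _ ≤ _ := lintegral_mono_set Ioc_subset_Ioi_self
  have h2 : (2 : ℝ≥0∞) * 2⁻¹ = 1 := ENNReal.mul_inv_cancel two_ne_zero ENNReal.ofNat_ne_top
  calc c * k = (2 * 2⁻¹) * (μ univ * (μ univ)⁻¹) * (c * k) := by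
        rw [h2, ENNReal.mul_inv_cancel h0 hM, one_mul, one_mul]
    _ = 2 * k / μ univ * (c * (μ univ / 2)) := by
        simp only [div_eq_mul_inv]; ring
    _ ≤ _ := by gcongr

end HalfMeasure

/-! ### Finiteness of the constant and the Sobolev inequality. -/

section Sobolev

variable {Ω : Type*} [MetricSpace Ω] [MeasurableSpace Ω] {μ : Measure Ω} {I : ℝ → ℝ}

/-- The constant `c_{X,I}` is finite as soon as the Hardy operator is bounded. -/
theorem constXI_lt_top (hres : Resonant μ) (hI : IsIsoperimetricEstimator μ I) (X : RINorm μ)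
    (hQ : X.BarBounded (hardyOp (μ univ) I)) (hM : μ univ < ∞) : X.constXI I < ∞ := by
  rcases hI.eq_zero_or_pos with hz | hpos
  · rw [RINorm.constXI, bar_eq_zero_of_estimator_eq_zero X hz]
    · exact ENNReal.zero_lt_top
    · intro t ht
      simp [indicator, ht]
  rcases eq_or_ne (μ univ) 0 with h0 | h0
  · have : X.constXI I = 0 := by
      rw [RINorm.constXI, ← X.bar_zero]
      congr 1
      ext t
      simp [h0]
    simp [this]
  obtain ⟨m, hm⟩ : ∃ m, (μ univ).toReal = m := ⟨_, rfl⟩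
  have hm0 : 0 < m := hm ▸ ENNReal.toReal_pos h0 hM.ne
  have hMm : μ univ = ENNReal.ofReal m := by rw [← hm, ENNReal.ofReal_toReal hM.ne]
  have hM2 : μ univ / 2 = ENNReal.ofReal (m / 2) := by rw [← hm, ofReal_half_toReal hM.ne]
  have hlt : ∀ t, 0 < t → (ENNReal.ofReal t < μ univ ↔ t < m) := fun t ht => by
    rw [hMm, ENNReal.ofReal_lt_ofReal_iff hm0]
  have hlt2 : ∀ t, (ENNReal.ofReal t < μ univ / 2 ↔ t < m / 2) := fun t => by
    rw [hM2, ENNReal.ofReal_lt_ofReal_iff (by positivity)]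
  have hcont : ContinuousOn I (Icc (m / 4) (m / 2)) := hI.continuous.mono fun t ht =>
    ⟨by linarith [ht.1], (hlt t (by linarith [ht.1])).2 (by linarith [ht.2])⟩
  obtain ⟨b, hb⟩ := isCompact_Icc.bddAbove_image hcont
  have hbI : ∀ t ∈ Icc (m / 4) (m / 2), I t ≤ b := fun t ht => hb (mem_image_of_mem _ ht)
  -- Test function: `g / I` is `1` on an interval of length `m / 4`, so for `t ≤ m / 4` the Hardy
  -- operator returns `(I t / t) * (m / 4)`. On the rest of `(0, m / 2)` the quotient `I t / t` is
  -- bounded.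
  set g : ℝ → ℝ≥0∞ := (Ioo (m / 4) (m / 2)).indicator fun t => ENNReal.ofReal (I t) with hg
  have hgm : AEMeasurable g (intervalMeasure (μ univ)) := by
    have : Measurable g := by
      rw [hg, ← piecewise_eq_indicator]
      exact (ENNReal.continuous_ofReal.comp_continuousOn
        (hcont.mono Ioo_subset_Icc_self)).measurable_piecewise continuousOn_const measurableSet_Ioo
    exact this.aemeasurable
  have hgle : ∀ t, g t ≤ ENNReal.ofReal b * 1 := fun t => by
    rw [mul_one]
    refine indicator_le' (s := Ioo (m / 4) (m / 2)) (g := fun _ => ENNReal.ofReal b)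
      (fun t ht => ENNReal.ofReal_le_ofReal (hbI t (Ioo_subset_Icc_self ht))) (fun _ _ => zero_le) t
  have hgtop : X.bar g < ∞ :=
    ((X.bar_mono (Eventually.of_forall hgle)).trans (X.bar_const_mul_le _ _)).trans_lt
      (ENNReal.mul_lt_top ENNReal.ofReal_lt_top (X.bar_one_lt_top hres hM))
  have hQg : ∀ t, 0 < t → t ≤ m / 4 →
      hardyOp (μ univ) I g t = ENNReal.ofReal (I t / t) * ENNReal.ofReal (m / 4) := by
    intro t ht htm
    rw [hardyOp]
    congr 1
    have h1 : ∀ s ∈ {s : ℝ | t < s ∧ ENNReal.ofReal s < μ univ / 2},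
        g s / ENNReal.ofReal (I s) = (Ioo (m / 4) (m / 2)).indicator 1 s := by
      intro s hs
      by_cases hs' : s ∈ Ioo (m / 4) (m / 2)
      · have hp : 0 < I s := hpos s (ht.trans hs.1) (lt_of_lt_half hs.2)
        rw [hg, indicator_of_mem hs', indicator_of_mem hs', Pi.one_apply]
        exact ENNReal.div_self (ENNReal.ofReal_pos.2 hp).ne' ENNReal.ofReal_ne_top
      · simp [hg, hs']
    have hset : {s : ℝ | t < s ∧ ENNReal.ofReal s < μ univ / 2} = Ioo t (m / 2) := by
      ext s
      exact and_congr_right fun _ => hlt2 s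
    rw [hset] at h1 ⊢
    rw [setLIntegral_congr_fun measurableSet_Ioo h1, lintegral_indicator_one measurableSet_Ioo,
      Measure.restrict_apply measurableSet_Ioo,
      inter_eq_self_of_subset_left (Ioo_subset_Ioo_left htm), Real.volume_Ioo]
    congr 1
    ring
  have hm4 : ENNReal.ofReal (m / 4) ≠ 0 := (ENNReal.ofReal_pos.2 (by positivity)).ne'
  have hle : ∀ t, {t : ℝ | 0 < t ∧ ENNReal.ofReal t < μ univ / 2}.indicator
      (fun t => ENNReal.ofReal (I t / t)) t ≤
      (ENNReal.ofReal (m / 4))⁻¹ * hardyOp (μ univ) I g t +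
        ENNReal.ofReal (b / (m / 4)) * 1 := by
    intro t
    by_cases ht : t ∈ {t : ℝ | 0 < t ∧ ENNReal.ofReal t < μ univ / 2}
    · rw [indicator_of_mem ht]
      rcases le_total t (m / 4) with htm | htm
      · rw [hQg t ht.1 htm, mul_comm (ENNReal.ofReal (I t / t)), ← mul_assoc,
          ENNReal.inv_mul_cancel hm4 ENNReal.ofReal_ne_top, one_mul]
        exact le_self_add
      · refine le_add_of_nonneg_of_le zero_le ?_
        rw [mul_one]
        have ht2 : t < m / 2 := (hlt2 t).1 ht.2
        have hIt := hbI t ⟨htm, ht2.le⟩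
        have hI0 := (hpos t ht.1 (lt_of_lt_half ht.2)).le
        exact ENNReal.ofReal_le_ofReal
          (div_le_div₀ (hI0.trans hIt) hIt (by positivity) htm)
    · rw [indicator_of_notMem ht]
      exact zero_le
  have hQm := aemeasurable_hardyOp hI g
  refine (X.bar_mono (Eventually.of_forall hle)).trans_lt ((X.bar_add_le (hQm.const_mul _)
    (aemeasurable_const.const_mul _)).trans_lt (ENNReal.add_lt_top.2 ⟨?_, ?_⟩))
  · refine (X.bar_const_mul_le _ _).trans_lt
      (ENNReal.mul_lt_top (ENNReal.inv_ne_top.2 hm4).lt_top ?_)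
    obtain ⟨C, hC⟩ := hQ
    exact (hC g hgm hgtop).trans_lt (ENNReal.mul_lt_top ENNReal.coe_lt_top hgtop)
  · exact (X.bar_const_mul_le _ _).trans_lt
      (ENNReal.mul_lt_top ENNReal.ofReal_lt_top (X.bar_one_lt_top hres hM))

variable [BorelSpace Ω]

/-- The Sobolev inequality, with an error term coming from the value `c` of the rearrangement at
the right endpoint. -/
theorem bar_rearr_mul_le (hres : Resonant μ) (hI : IsIsoperimetricEstimator μ I)
    (hpos : ∀ t, 0 < t → ENNReal.ofReal t < μ univ → 0 < I t) (X : RINorm μ)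
    (hQ : X.BarBounded (hardyOp (μ univ) I)) {f : Ω → ℝ} {K : ℝ≥0} (hf : LipschitzWith K f)
    (hA : μ (tsupport f) < ∞) (c : ℝ≥0∞)
    (hc : ∀ t, 0 < t → ENNReal.ofReal t < μ univ / 2 → rearr μ (fun x => ‖f x‖ₑ) t ≤
      volume {r : ℝ | 0 < r ∧ realDistrib μ f r ∈
        {s | t < s ∧ ENNReal.ofReal s < μ univ / 2}} + c) :
    X.bar ({t : ℝ | 0 < t ∧ ENNReal.ofReal t < μ univ / 2}.indicator fun t =>
        rearr μ (fun x => ‖f x‖ₑ) t * ENNReal.ofReal (I t / t)) ≤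
      X.barOpNorm (hardyOp (μ univ) I) * X.norm (gradMod f) + c * X.constXI I := by
  have := hres.sigmaFinite
  have h0 : distrib μ (fun x => ‖f x‖ₑ) 0 ≠ ∞ := by
    refine ne_top_of_le_ne_top hA.ne (measure_mono fun x hx => subset_tsupport f ?_)
    simpa using hx
  have hGm := (measurable_gradMod hf.continuous).aemeasurable (μ := μ)
  have hN := norm_gradMod_lt_top X hf hA
  obtain ⟨ψ, hψm, hψ, hψle⟩ := exists_rearr_density hI hpos hf h0
    (lintegral_gradMod_lt_top hf hA).ne
  set φ : ℝ → ℝ≥0∞ := fun t => {t : ℝ | 0 < t ∧ ENNReal.ofReal t < μ univ}.indicator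
    (fun t => ENNReal.ofReal (I t)) t * ψ t with hφ
  have hφm : AEMeasurable φ (intervalMeasure (μ univ)) :=
    (hI.measurable_indicator.mul hψm).aemeasurable
  have hφle : X.bar φ ≤ X.norm (gradMod f) :=
    X.bar_le_norm hres hφm (X.isMZero_of_norm_lt_top hGm hN) hψle
  -- The factor `I` of `φ` cancels the weight `1 / I`, leaving `∫ ψ` over `(t, M/2)`, a length of
  -- levels.
  have hQφ : ∀ t, 0 < t → hardyOp (μ univ) I φ t = ENNReal.ofReal (I t / t) *
      volume {r : ℝ | 0 < r ∧ realDistrib μ f r ∈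
        {s | t < s ∧ ENNReal.ofReal s < μ univ / 2}} := by
    intro t ht
    have hS : MeasurableSet {s : ℝ | t < s ∧ ENNReal.ofReal s < μ univ / 2} :=
      measurableSet_Ioi.inter (measurableSet_lt ENNReal.measurable_ofReal measurable_const)
    have hSJ : ∀ s ∈ {s : ℝ | t < s ∧ ENNReal.ofReal s < μ univ / 2},
        s ∈ {t : ℝ | 0 < t ∧ ENNReal.ofReal t < μ univ} := fun s hs =>
      ⟨ht.trans hs.1, lt_of_lt_half hs.2⟩
    rw [hardyOp, hψ _ hS hSJ]
    congr 1
    refine setLIntegral_congr_fun hS fun s hs => ?_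
    have hp := ENNReal.ofReal_pos.2 (hpos s (hSJ s hs).1 (hSJ s hs).2)
    simp only [hφ]
    rw [indicator_of_mem (hSJ s hs), mul_comm,
      ENNReal.mul_div_cancel_right hp.ne' ENNReal.ofReal_ne_top]
  have hle : ∀ t, {t : ℝ | 0 < t ∧ ENNReal.ofReal t < μ univ / 2}.indicator (fun t =>
        rearr μ (fun x => ‖f x‖ₑ) t * ENNReal.ofReal (I t / t)) t ≤
      hardyOp (μ univ) I φ t + c * {t : ℝ | 0 < t ∧ ENNReal.ofReal t < μ univ / 2}.indicator
        (fun t => ENNReal.ofReal (I t / t)) t := by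
    intro t
    by_cases ht : t ∈ {t : ℝ | 0 < t ∧ ENNReal.ofReal t < μ univ / 2}
    · rw [indicator_of_mem ht, indicator_of_mem ht, hQφ t ht.1, mul_comm (ENNReal.ofReal _),
        ← add_mul]
      gcongr
      exact hc t ht.1 ht.2
    · rw [indicator_of_notMem ht]
      exact zero_le
  refine (X.bar_mono (Eventually.of_forall hle)).trans ((X.bar_add_le (aemeasurable_hardyOp hI φ)
    (((aemeasurable_ofReal_div hI).indicator (measurableSet_ofReal_lt _)).const_mul c)).trans
    (add_le_add ?_ (X.bar_const_mul_le _ _)))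
  refine (X.isBarBound_barOpNorm hQ φ hφm (hφle.trans_lt hN)).trans ?_
  gcongr

end Sobolev

end RISobolev

theorem theorem6p1 {Ω : Type*} [MetricSpace Ω] [ConnectedSpace Ω] [MeasurableSpace Ω]
    [BorelSpace Ω] (μ : Measure Ω) [IsFiniteMeasureOnCompacts μ]
    (hres : RISobolev.Resonant μ) (I : ℝ → ℝ) (hI : RISobolev.IsIsoperimetricEstimator μ I)
    (X : RISobolev.RINorm μ) (hQ : X.BarBounded (RISobolev.hardyOp (μ univ) I)) :
    (μ univ < ∞ →
      X.constXI I < ∞ ∧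
      ∀ f : Ω → ℝ, RISobolev.IsLip f → (∃ B : ℝ, ∀ x, |f x| ≤ B) →
        X.bar ({t : ℝ | 0 < t ∧ ENNReal.ofReal t < μ univ / 2}.indicator fun t =>
            RISobolev.rearr μ (fun x => ‖f x‖ₑ) t * ENNReal.ofReal (I t / t))
          ≤ X.barOpNorm (RISobolev.hardyOp (μ univ) I) * X.norm (RISobolev.gradMod f)
            + 2 * X.constXI I / μ univ * ∫⁻ x, ‖f x‖ₑ ∂μ) ∧
    (μ univ = ∞ →
      ∀ f : Ω → ℝ, RISobolev.IsLipCompact f →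
        X.bar (fun t => RISobolev.rearr μ (fun x => ‖f x‖ₑ) t * ENNReal.ofReal (I t / t))
          ≤ X.barOpNorm (RISobolev.hardyOp (μ univ) I) * X.norm (RISobolev.gradMod f)) := by
  have := hres.sigmaFinite
  refine ⟨fun hM => ⟨RISobolev.constXI_lt_top hres hI X hQ hM, fun f hf _ => ?_⟩, fun hM f hf => ?_⟩
  · obtain ⟨K, hK⟩ := hf
    rcases hI.eq_zero_or_pos with hz | hpos
    · rw [RISobolev.bar_eq_zero_of_estimator_eq_zero X hz]
      · exact zero_le
      · intro t ht
        simp [indicator, ht]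
    have hA : μ (tsupport f) < ∞ := (measure_mono (subset_univ _)).trans_lt hM
    rcases eq_or_ne (μ univ) 0 with h0 | h0
    · have : ({t : ℝ | 0 < t ∧ ENNReal.ofReal t < μ univ / 2}.indicator fun t =>
          RISobolev.rearr μ (fun x => ‖f x‖ₑ) t * ENNReal.ofReal (I t / t)) = fun _ => 0 := by
        ext t
        simp [h0]
      rw [this, X.bar_zero]
      exact zero_le
    have hm0 : 0 < (μ univ).toReal := ENNReal.toReal_pos h0 hM.ne
    have hd : RISobolev.distrib μ (fun x => ‖f x‖ₑ) 0 ≠ ∞ :=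
      ((measure_mono (subset_univ _)).trans_lt hM).ne
    refine (RISobolev.bar_rearr_mul_le hres hI hpos X hQ hK hA
      (RISobolev.rearr μ (fun x => ‖f x‖ₑ) ((μ univ).toReal / 2)) fun t ht htM => ?_).trans ?_
    · rw [RISobolev.rearr_eq_volume hd ht.le, RISobolev.rearr_eq_volume hd (by positivity)]
      -- The levels with `λ > t` split by `λ < M/2`, `λ = M/2`, `λ > M/2`. The middle ones are
      -- negligible because the image of `dr` has a density on `(0, M)`; the last have length
      -- `f*(M/2)`.
      have hnull : volume {r : ℝ | 0 < r ∧ RISobolev.realDistrib μ f r ∈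
          ({(μ univ).toReal / 2} : Set ℝ)} = 0 := by
        obtain ⟨ψ, -, hψ, -⟩ := RISobolev.exists_rearr_density hI hpos hK hd
          (RISobolev.lintegral_gradMod_lt_top hK hA).ne
        rw [hψ _ (measurableSet_singleton _), setLIntegral_measure_zero _ _ (by simp)]
        rintro s rfl
        refine ⟨by positivity, ?_⟩
        rw [RISobolev.ofReal_half_toReal hM.ne]
        exact ENNReal.half_lt_self h0 hM.ne
      rw [← RISobolev.ofReal_half_toReal hM.ne] at htM ⊢
      refine (measure_mono ?_).trans ((measure_union_le _ _).trans (add_le_add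
        ((measure_union_le _ _).trans (add_le_of_nonpos_right hnull.le)) le_rfl))
      rintro r ⟨hr, htr⟩
      rcases lt_trichotomy (RISobolev.realDistrib μ f r) ((μ univ).toReal / 2) with h | h | h
      · exact Or.inl (Or.inl ⟨hr, htr, (ENNReal.ofReal_lt_ofReal_iff (by positivity)).2 h⟩)
      · exact Or.inl (Or.inr ⟨hr, h⟩)
      · exact Or.inr ⟨hr, h⟩
    · refine add_le_add le_rfl ?_
      exact RISobolev.rearr_half_mul_le hM.ne h0 hK.continuous.measurable.enorm.aemeasurable _
  · obtain ⟨⟨K, hK⟩, hsupp⟩ := hf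
    rcases hI.eq_zero_or_pos with hz | hpos
    · rw [RISobolev.bar_eq_zero_of_estimator_eq_zero X hz]
      · exact zero_le
      · intro t ht
        simp [ht]
    have hA : μ (tsupport f) < ∞ := hsupp.isCompact.measure_lt_top
    have hd : RISobolev.distrib μ (fun x => ‖f x‖ₑ) 0 ≠ ∞ := by
      refine ne_top_of_le_ne_top hA.ne (measure_mono fun x hx => subset_tsupport f ?_)
      simpa using hx
    have hM2 : μ univ / 2 = ∞ := by rw [hM, ENNReal.top_div_of_ne_top ENNReal.ofNat_ne_top]
    -- With `M/2 = ∞` the interval `(t, M/2)` captures every level with `λ > t`, so no endpoint term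
    -- remains.
    have hmain := RISobolev.bar_rearr_mul_le hres hI hpos X hQ hK hA 0 fun t ht _ => by
      rw [RISobolev.rearr_eq_volume hd ht.le, hM2, add_zero]
      exact measure_mono fun r hr => ⟨hr.1, hr.2, ENNReal.ofReal_lt_top⟩
    rw [zero_mul, add_zero] at hmain
    refine le_trans (X.bar_mono ?_) hmain
    refine ae_restrict_of_forall_mem (RISobolev.measurableSet_ofReal_lt _) fun t ht => ?_
    rw [indicator_of_mem (by exact ⟨ht.1, by rw [hM2]; exact ENNReal.ofReal_lt_top⟩)]
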